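/- Let $q$ be a complex number with $0<|q|<1$. Write $(u;q)_m=\prod_{i=0}^{m-1}(1-uq^i)$ for integers $m\ge 0$, $(u;q)_\infty=\prod_{i=0}^{\infty}(1-uq^i)$, and $(u_1,\dots,u_r;q)_m=(u_1;q)_m\cdots(u_r;q)_m$ for $0\le m\le\infty$. Let $n\ge 0$ be an integer and let $x,y,b,c,d,e$ be nonzero complex numbers such that no denominator below vanishes, that is: $uq^j\neq 1$ for all integers $j\ge 0$ and every $u$ among $y$, $xy$, $\frac{b}{y}$, $\frac{c}{y}$, $\frac{d}{y}$, $\frac{e}{y}$, $\frac{b}{xy}$, $\frac{c}{xy}$, $\frac{d}{xy}$, $\frac{e}{xy}$, $\frac{q^{-n}y}{e}$, $\frac{q^{-n}xy}{e}$; and $uq^j\ne 1$ for $0\le j<n$ and $u\in\{\frac{q^{1-n}}{e},\frac{qe}{xy^2}\}$. If $$\left|\frac{bcd}{xy^2q^{n+1}}\right|<1,$$ then the two infinite series below converge absolutely and $$\sum_{k=0}^{\infty}\Big(1-\frac{q^{2k+1}}{x}\Big)\frac{\big(\frac{q}{xy},\frac{q^{-k}b}{y},\frac{q^{-k}c}{y},\frac{q^{-k}d}{y},\frac{q^{-k}e}{y},\frac{q^{-k-n}xy}{e};q\big)_k}{\big(y,\frac{b}{xy},\frac{c}{xy},\frac{d}{xy},\frac{e}{xy},\frac{q^{-n}y}{e};q\big)_{k+1}}\,q^{k(5k+3)/2}\Big(-\frac{y}{x^2}\Big)^k$$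 $$-\;x^2\sum_{k=0}^{\infty}\big(1-q^{2k+1}x\big)\frac{\big(\frac{q}{y},\frac{q^{-k}b}{xy},\frac{q^{-k}c}{xy},\frac{q^{-k}d}{xy},\frac{q^{-k}e}{xy},\frac{q^{-k-n}y}{e};q\big)_k}{\big(xy,\frac{b}{y},\frac{c}{y},\frac{d}{y},\frac{e}{y},\frac{q^{-n}xy}{e};q\big)_{k+1}}\,q^{k(5k+3)/2}(-x^3y)^k$$ $$=\frac{\big(q,x,\frac{q}{x},b,c,d,\frac{bc}{xy^2},\frac{bd}{xy^2},\frac{cd}{xy^2};q\big)_\infty}{\big(y,xy,\frac{b}{y},\frac{c}{y},\frac{d}{y},\frac{b}{xy},\frac{c}{xy},\frac{d}{xy},\frac{bcd}{qxy^2};q\big)_\infty}\cdot\frac{eq^n}{(-y)}\cdot\frac{\big(e,\frac{qe}{xy^2};q\big)_n}{\big(\frac{e}{y},\frac{e}{xy};q\big)_{n+1}}\cdot{}_4\phi_3\!\left[{q^{-n},\ \frac{q}{b},\ \frac{q}{c},\ \frac{q}{d}\atop \frac{q^{1-n}}{e},\ \frac{qe}{xy^2},\ \frac{q^2xy^2}{bcd}};q,q\right],$$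 where ${}_4\phi_3$ is the terminating basic hypergeometric series $${}_4\phi_3\!\left[{q^{-n},\alpha_1,\alpha_2,\alpha_3\atop \beta_1,\beta_2,\beta_3};q,q\right]=\sum_{k=0}^{n}\frac{(q^{-n},\alpha_1,\alpha_2,\alpha_3;q)_k}{(q,\beta_1,\beta_2,\beta_3;q)_k}\,q^k .$$ -/

import Mathlib

open scoped BigOperators

noncomputable section

/-- The `q`-shifted factorial `(x; q)_n` for `n ≥ 0`. -/
def qShift (x q : ℂ) (n : ℕ) : ℂ := ∏ i ∈ Finset.range n, (1 - x * q ^ i)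

/-- The `q`-shifted factorial of infinite order `(x; q)_∞`, used for `|q| < 1`, where the
infinite product converges. -/
def qShiftInf (x q : ℂ) : ℂ := ∏' k : ℕ, (1 - x * q ^ k)

/-- The compact notation `(a, b, …, c; q)_n`. -/
def qShiftList (l : List ℂ) (q : ℂ) (n : ℕ) : ℂ := (l.map fun x => qShift x q n).prod

/-- The compact notation `(a, b, …, c; q)_∞`. -/
def qShiftInfList (l : List ℂ) (q : ℂ) : ℂ := (l.map fun x => qShiftInf x q).prod

/-- The unilateral basic hypergeometric series `_{1+r}φ_s` with upper parameters
`as = [a₀, …, a_r]`, lower parameters `bs = [b₁, …, b_s]`, base `q` and argument `z`.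
If some upper parameter is `q⁻ⁿ`, all terms with index `k > n` are zero. -/
def basicHypergeometric (as bs : List ℂ) (q z : ℂ) : ℂ :=
  ∑' k : ℕ, qShiftList as q k / qShiftList (q :: bs) q k
    * ((-1) ^ k * q ^ (k.choose 2)) ^ ((bs.length : ℤ) + 1 - (as.length : ℤ)) * z ^ k

/-- The `k`-th term of the first series on the left-hand side. The exponent `k(5k+3)/2` is
an integer because `k(5k+3)` is even. -/
def firstTerm (q x y b c d e : ℂ) (n k : ℕ) : ℂ :=
  (1 - q ^ (2 * k + 1) / x)
    * (qShiftList [q / (x * y), q ^ (-(k : ℤ)) * b / y, q ^ (-(k : ℤ)) * c / y,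
          q ^ (-(k : ℤ)) * d / y, q ^ (-(k : ℤ)) * e / y,
          q ^ (-(k : ℤ) - (n : ℤ)) * x * y / e] q k
      / qShiftList [y, b / (x * y), c / (x * y), d / (x * y), e / (x * y),
          q ^ (-(n : ℤ)) * y / e] q (k + 1))
    * q ^ (k * (5 * k + 3) / 2) * (-y / x ^ 2) ^ k

/-- The `k`-th term of the second series on the left-hand side. -/
def secondTerm (q x y b c d e : ℂ) (n k : ℕ) : ℂ :=
  (1 - q ^ (2 * k + 1) * x)
    * (qShiftList [q / y, q ^ (-(k : ℤ)) * b / (x * y), q ^ (-(k : ℤ)) * c / (x * y),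
          q ^ (-(k : ℤ)) * d / (x * y), q ^ (-(k : ℤ)) * e / (x * y),
          q ^ (-(k : ℤ) - (n : ℤ)) * y / e] q k
      / qShiftList [x * y, b / y, c / y, d / y, e / y,
          q ^ (-(n : ℤ)) * x * y / e] q (k + 1))
    * q ^ (k * (5 * k + 3) / 2) * (-(x ^ 3 * y)) ^ k

end

/-! ### Finite and infinite `q`-shifted factorials -/

open Filter Topology

/-! Put a = q/x, u₁ = xy/q, u₂ = b/(qy), u₃ = c/(qy), u₄ = d/(qy), w = e/(qy), w' = q^(-n)xy/(qe).
Up to one common constant, the k-th term of the first series and -x² times the k-th term of the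
second are the terms of index k and -(k+1) of a single bilateral very-well-poised series: 1 - a
q^(2k), times (q a²)^k (aq)^k, times a factor u^k (1/u;q)_k/(aqu;q)_k for each of the six
parameters. The claim is thus the evaluation of one sum over ℤ.

With only u₁, …, u₄ this is Bailey's ₆ψ₆ sum (`wpSum_eq`). A telescoping identity
(`contiguous_relation`) relates the series at u₁ and at q u₁; iterating it sends u₁ to 0, and doing
so for each parameter reduces everything to the series without parameters (`wpSum_eq_zero`). For u₁
= 1, u₂ = 1/a only the term k = 0 survives, so the same reduction, read backwards, evaluates the
parameter-free series; this is the Jacobi triple product (`wpSum_zero`).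

The remaining pair satisfies a w w' q^(n+1) = 1 and so contributes only a Laurent polynomial in q^k
(`wpFactor_mul_wpFactor`). The `q`-Saalschütz sum expands it in the products (q^k/u₁;q)_j (1/(a q^k
u₁);q)_j. Multiplying the weight by such a product amounts to replacing u₁ by u₁/q^j, so j
applications of the contiguous relation evaluate each piece (`tsum_mul_qShift`), and the pieces add
up to the ₄φ₃. The convergence hypothesis says that the weight decays fast enough for n such steps.
-/

theorem qShift_zero (x q : ℂ) : qShift x q 0 = 1 := by simp [qShift]

theorem qShift_succ (x q : ℂ) (n : ℕ) :
    qShift x q (n + 1) = qShift x q n * (1 - x * q ^ n) := by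
  simp [qShift, Finset.prod_range_succ]

theorem qShift_succ' (x q : ℂ) (n : ℕ) :
    qShift x q (n + 1) = (1 - x) * qShift (x * q) q n := by
  simp only [qShift, Finset.prod_range_succ', pow_zero, mul_one]
  rw [mul_comm]
  congr 1
  exact Finset.prod_congr rfl fun i _ => by ring

theorem qShift_add (x q : ℂ) (m n : ℕ) :
    qShift x q (m + n) = qShift x q m * qShift (x * q ^ m) q n := by
  simp only [qShift, Finset.prod_range_add]
  congr 1
  exact Finset.prod_congr rfl fun i _ => by ring

theorem qShift_ne_zero {x q : ℂ} {n : ℕ} (h : ∀ i < n, x * q ^ i ≠ 1) : qShift x q n ≠ 0 := by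
  rw [qShift, Finset.prod_ne_zero_iff]
  exact fun i hi => sub_ne_zero.2 (h i (Finset.mem_range.1 hi)).symm

theorem summable_norm_mul_pow {q : ℂ} (hq : ‖q‖ < 1) (x : ℂ) :
    Summable fun i : ℕ => ‖-(x * q ^ i)‖ := by
  simp only [norm_neg, norm_mul, norm_pow]
  exact (summable_geometric_of_lt_one (norm_nonneg _) hq).mul_left _

theorem multipliable_qShift {q : ℂ} (hq : ‖q‖ < 1) (x : ℂ) :
    Multipliable fun i : ℕ => 1 - x * q ^ i := by
  simpa [sub_eq_add_neg] using multipliable_one_add_of_summable (summable_norm_mul_pow hq x)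

theorem tendsto_qShift {q : ℂ} (hq : ‖q‖ < 1) (x : ℂ) :
    Tendsto (qShift x q) atTop (𝓝 (qShiftInf x q)) :=
  (multipliable_qShift hq x).hasProd.tendsto_prod_nat

theorem qShiftInf_ne_zero {q x : ℂ} (hq : ‖q‖ < 1) (h : ∀ i : ℕ, x * q ^ i ≠ 1) :
    qShiftInf x q ≠ 0 := by
  have := tprod_one_add_ne_zero_of_summable (f := fun i : ℕ => -(x * q ^ i))
    (fun i => by simpa [← sub_eq_add_neg, sub_eq_zero] using (h i).symm)
    (summable_norm_mul_pow hq x)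
  simpa [qShiftInf, sub_eq_add_neg] using this

theorem qShiftInf_zero_left (q : ℂ) : qShiftInf 0 q = 1 := by simp [qShiftInf]

theorem qShiftInf_eq_mul {q : ℂ} (hq : ‖q‖ < 1) (x : ℂ) :
    qShiftInf x q = (1 - x) * qShiftInf (x * q) q := by
  refine tendsto_nhds_unique ((tendsto_qShift hq x).comp (tendsto_add_atTop_nat 1)) ?_
  simpa [Function.comp_def, qShift_succ'] using (tendsto_qShift hq (x * q)).const_mul (1 - x)

theorem qShiftInf_eq_zero {q x : ℂ} (hq : ‖q‖ < 1) {i : ℕ} (h : x * q ^ i = 1) :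
    qShiftInf x q = 0 := by
  induction i generalizing x with
  | zero => rw [qShiftInf_eq_mul hq]; simp at h; simp [h]
  | succ i ih => rw [qShiftInf_eq_mul hq, ih (by rw [← h]; ring), mul_zero]

/-! ### Well-poised factors indexed by ℤ: recurrence, shift, bounds -/

/-- Uniform bound for quotients of shifted factorials. -/
theorem exists_bound_prod_div {q v : ℂ} (hq : ‖q‖ < 1) (hv : ∀ i : ℕ, v * q ^ i ≠ 1)
    {ρ : ℝ} (hρ : 0 < ρ) :
    ∃ C : ℝ, 0 ≤ C ∧ ∀ (m k : ℕ) (w : ℂ), ‖w‖ ≤ ρ →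
      ‖∏ i ∈ Finset.range k, (w - q ^ i) / (1 - v * q ^ m * q ^ i)‖ ≤ C * ρ ^ k := by
  have hlim := tendsto_qShift hq v
  have hne : ∀ n, qShift v q n ≠ 0 := fun n => qShift_ne_zero fun i _ => hv i
  obtain ⟨C₁, hC₁⟩ := hlim.norm.bddAbove_range
  obtain ⟨C₂, hC₂⟩ := (hlim.inv₀ (qShiftInf_ne_zero hq hv)).norm.bddAbove_range
  have h1 : ∀ n, ‖qShift v q n‖ ≤ C₁ := fun n => hC₁ ⟨n, rfl⟩
  have h2 : ∀ n, ‖(qShift v q n)⁻¹‖ ≤ C₂ := fun n => hC₂ ⟨n, rfl⟩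
  have hC₁0 : 0 ≤ C₁ := (norm_nonneg _).trans (h1 0)
  have hC₂0 : 0 ≤ C₂ := (norm_nonneg _).trans (h2 0)
  -- The exponential bounds ∏ (1 + ρ⁻¹‖q‖^i), left over when ρ^k is taken out of the numerator. C₁C₂
  -- bounds (v;q)_m / (v;q)_(m+k), a quotient of terms of a sequence with nonzero limit.
  refine ⟨Real.exp (ρ⁻¹ * (1 - ‖q‖)⁻¹) * (C₁ * C₂), by positivity, fun m k w hw => ?_⟩
  have hden : (∏ i ∈ Finset.range k, (1 - v * q ^ m * q ^ i))⁻¹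
      = qShift v q m * (qShift v q (m + k))⁻¹ := by
    rw [qShift_add, mul_inv, mul_inv_cancel_left₀ (hne m)]; rfl
  have hnum : ‖∏ i ∈ Finset.range k, (w - q ^ i)‖ ≤ Real.exp (ρ⁻¹ * (1 - ‖q‖)⁻¹) * ρ ^ k := by
    calc ‖∏ i ∈ Finset.range k, (w - q ^ i)‖
        = ∏ i ∈ Finset.range k, ‖w - q ^ i‖ := norm_prod _ _
      _ ≤ ∏ i ∈ Finset.range k, ((1 + ρ⁻¹ * ‖q‖ ^ i) * ρ) := by
          refine Finset.prod_le_prod (fun _ _ => norm_nonneg _) fun i _ => ?_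
          calc ‖w - q ^ i‖ ≤ ‖w‖ + ‖q ^ i‖ := norm_sub_le _ _
            _ ≤ ρ + ‖q‖ ^ i := by rw [norm_pow]; linarith
            _ = (1 + ρ⁻¹ * ‖q‖ ^ i) * ρ := by field_simp
      _ = (∏ i ∈ Finset.range k, (1 + ρ⁻¹ * ‖q‖ ^ i)) * ρ ^ k := by
          rw [Finset.prod_mul_distrib]; simp
      _ ≤ _ := by
          gcongr
          refine (Real.prod_one_add_le_exp_sum _ fun i => by positivity).trans ?_
          rw [← Finset.mul_sum]
          gcongr
          rw [← tsum_geometric_of_lt_one (norm_nonneg _) hq]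
          exact (summable_geometric_of_lt_one (norm_nonneg _) hq).sum_le_tsum _
            fun i _ => by positivity
  rw [Finset.prod_div_distrib, div_eq_mul_inv, hden, norm_mul, norm_mul]
  calc _ ≤ (Real.exp (ρ⁻¹ * (1 - ‖q‖)⁻¹) * ρ ^ k) * (C₁ * C₂) := by
        gcongr
        · exact h1 m
        · exact h2 _
    _ = _ := by ring

/-- A first order recurrence on `ℤ` determines its solution from the value at `0`. -/
theorem eq_of_recurrence {F G α β : ℤ → ℂ} (hα : ∀ k : ℕ, α k ≠ 0)
    (hβ : ∀ k : ℕ, β (-(k + 1)) ≠ 0) (hF : ∀ k, F (k + 1) * α k = F k * β k)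
    (hG : ∀ k, G (k + 1) * α k = G k * β k) (h0 : F 0 = G 0) (k : ℤ) : F k = G k := by
  induction k using Int.induction_on with
  | zero => exact h0
  | succ k ih => exact mul_right_cancel₀ (hα k) (by rw [hF, hG, ih])
  | pred k ih =>
    have h1 := hF (-k - 1)
    have h2 := hG (-k - 1)
    have h3 := hβ k
    rw [sub_add_cancel] at h1 h2
    rw [neg_add'] at h3
    exact mul_right_cancel₀ h3 (by rw [← h1, ← h2, ih])

/-- The quotient `u ^ k (1/u; q)_k / (a q u; q)_k`, extended to `u = 0` and to negative `k`. -/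
noncomputable def wpFactor (q a u : ℂ) : ℤ → ℂ
  | Int.ofNat k => ∏ i ∈ Finset.range k, (u - q ^ i) / (1 - a * q * u * q ^ i)
  | Int.negSucc k => ∏ i ∈ Finset.range (k + 1), q * ((a * u - q ^ i) / (1 - q * u * q ^ i))

/-- The parameters `u` at which no `wpFactor q a u k` has a vanishing denominator. -/
def WPAdmissible (q a u : ℂ) : Prop :=
  (∀ i : ℕ, a * q * u * q ^ i ≠ 1) ∧ ∀ i : ℕ, q * u * q ^ i ≠ 1

theorem wpFactor_natCast (q a u : ℂ) (k : ℕ) :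
    wpFactor q a u k = ∏ i ∈ Finset.range k, (u - q ^ i) / (1 - a * q * u * q ^ i) := rfl

theorem wpFactor_neg (q a u : ℂ) (k : ℕ) :
    wpFactor q a u (-k) = ∏ i ∈ Finset.range k, q * ((a * u - q ^ i) / (1 - q * u * q ^ i)) := by
  cases k with
  | zero => exact wpFactor_natCast q a u 0
  | succ k => rfl

theorem wpFactor_zero (q a u : ℂ) : wpFactor q a u 0 = 1 := by
  simpa using wpFactor_natCast q a u 0

theorem wpFactor_add_one {q a u : ℂ} (hq : q ≠ 0) (hu : WPAdmissible q a u) (k : ℤ) :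
    wpFactor q a u (k + 1) * (1 - a * q * u * q ^ k) = wpFactor q a u k * (u - q ^ k) := by
  rcases Int.eq_nat_or_neg k with ⟨n, rfl | rfl⟩
  · have h : 1 - a * q * u * q ^ n ≠ 0 := sub_ne_zero.2 (hu.1 n).symm
    have : ((n : ℤ) + 1) = ((n + 1 : ℕ) : ℤ) := by push_cast; ring
    rw [this, wpFactor_natCast, wpFactor_natCast, Finset.prod_range_succ, zpow_natCast,
      mul_assoc, div_mul_cancel₀ _ h]
  · cases n with
    | zero =>
      have := wpFactor_natCast q a u 1
      have h : 1 - a * q * u ≠ 0 := sub_ne_zero.2 (by simpa using (hu.1 0).symm)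
      simp at this
      simp [wpFactor_zero, this, h]
    | succ n =>
      have h : 1 - q * u * q ^ n ≠ 0 := sub_ne_zero.2 (hu.2 n).symm
      have : (-((n + 1 : ℕ) : ℤ) + 1) = -(n : ℤ) := by push_cast; ring
      rw [this, wpFactor_neg, wpFactor_neg, Finset.prod_range_succ, zpow_neg, zpow_natCast]
      field_simp
      ring

theorem WPAdmissible.mul_pow {q a u : ℂ} (hu : WPAdmissible q a u) (m : ℕ) :
    WPAdmissible q a (q ^ m * u) := by
  refine ⟨fun i h => hu.1 (m + i) ?_, fun i h => hu.2 (m + i) ?_⟩ <;> rw [← h] <;> ring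

theorem WPAdmissible.zero (q a : ℂ) : WPAdmissible q a 0 := by
  constructor <;> intro i <;> simp

/-- Both sides satisfy the same first-order recurrence in k and agree at k = 0. The multiplier on
the left is the one in `contiguous_relation`, which thereby compares the parameters u and qu. -/
theorem wpFactor_mul_q {q a u : ℂ} (hq : q ≠ 0) (hu : WPAdmissible q a u) (k : ℤ) :
    wpFactor q a (q * u) k * ((q ^ k - q * u) * (1 - a * q ^ k * (q * u)) / q ^ k)
      = (1 - q * u) * (1 - a * q * u) * wpFactor q a u k := by
  have hu' : WPAdmissible q a (q * u) := by simpa using hu.mul_pow 1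
  refine eq_of_recurrence (α := fun k => 1 - a * q * u * q ^ k) (β := fun k => u - q ^ k)
    (F := fun k => wpFactor q a (q * u) k * ((q ^ k - q * u) * (1 - a * q ^ k * (q * u)) / q ^ k))
    (G := fun k => (1 - q * u) * (1 - a * q * u) * wpFactor q a u k)
    (fun n => ?_) (fun n => ?_) (fun k => ?_) (fun k => ?_) ?_ k
  · simpa [sub_eq_zero] using (hu.1 n).symm
  · intro h
    rw [sub_eq_zero] at h
    apply hu.2 n
    rw [h, zpow_neg, zpow_add₀ hq, zpow_natCast, zpow_one]
    field_simp
  · have h := wpFactor_add_one hq hu' k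
    have hK : q ^ k ≠ 0 := zpow_ne_zero _ hq
    simp only [zpow_add₀ hq, zpow_one]
    generalize q ^ k = K at *
    field_simp
    linear_combination (K - u) * (1 - a * q * u * K) * h
  · linear_combination (1 - q * u) * (1 - a * q * u) * wpFactor_add_one hq hu k
  · simp only [wpFactor_zero, zpow_zero]; ring

/-- Uniformity in m is what dominated convergence needs when a parameter is sent to 0. A free ρ > 0
replaces ‖u‖ because at u = 0 the factor is nonzero and no bound C‖u‖^k can hold. -/
theorem exists_bound_wpFactor {q a u : ℂ} (hq0 : q ≠ 0) (hq : ‖q‖ < 1) (ha : a ≠ 0)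
    (hu : WPAdmissible q a u) {ρ : ℝ} (hρ : 0 < ρ) (huρ : ‖u‖ ≤ ρ) :
    ∃ C : ℝ, 0 ≤ C ∧ ∀ m k : ℕ, ‖wpFactor q a (q ^ m * u) k‖ ≤ C * ρ ^ k ∧
      ‖wpFactor q a (q ^ m * u) (-k)‖ ≤ C * (‖q‖ * ‖a‖ * ρ) ^ k := by
  have haρ : 0 < ‖a‖ * ρ := mul_pos (norm_pos_iff.2 ha) hρ
  obtain ⟨C₁, h1, hC₁⟩ := exists_bound_prod_div hq hu.1 hρ
  obtain ⟨C₂, h2, hC₂⟩ := exists_bound_prod_div hq hu.2 haρ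
  have hm : ∀ m : ℕ, ‖q ^ m * u‖ ≤ ρ := fun m => by
    rw [norm_mul, norm_pow]
    exact (mul_le_of_le_one_left (norm_nonneg _)
      (pow_le_one₀ (norm_nonneg _) hq.le)).trans huρ
  refine ⟨max C₁ C₂, h1.trans (le_max_left _ _), fun m k => ⟨?_, ?_⟩⟩
  · have := hC₁ m k (q ^ m * u) (hm m)
    rw [wpFactor_natCast]
    calc _ = ‖∏ i ∈ Finset.range k, (q ^ m * u - q ^ i) / (1 - a * q * u * q ^ m * q ^ i)‖ := by
          congr 1; exact Finset.prod_congr rfl fun i _ => by congr 1; ring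
      _ ≤ _ := this
      _ ≤ _ := by gcongr; exact le_max_left _ _
  · have := hC₂ m k (a * (q ^ m * u)) (by rw [norm_mul]; gcongr; exact hm m)
    rw [wpFactor_neg, Finset.prod_mul_distrib, Finset.prod_const, Finset.card_range, norm_mul,
      norm_pow]
    calc _ = ‖q‖ ^ k * ‖∏ i ∈ Finset.range k,
            (a * (q ^ m * u) - q ^ i) / (1 - q * u * q ^ m * q ^ i)‖ := by
          congr 2; exact Finset.prod_congr rfl fun i _ => by congr 1; ring
      _ ≤ ‖q‖ ^ k * (max C₁ C₂ * (‖a‖ * ρ) ^ k) := by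
          gcongr
          exact this.trans (by gcongr; exact le_max_right _ _)
      _ = _ := by rw [mul_assoc ‖q‖, mul_pow ‖q‖]; ring

theorem tendsto_wpFactor {q : ℂ} (hq : ‖q‖ < 1) (a u : ℂ) (k : ℤ) :
    Tendsto (fun m : ℕ => wpFactor q a (q ^ m * u) k) atTop (𝓝 (wpFactor q a 0 k)) := by
  have h0 : Tendsto (fun m : ℕ => q ^ m * u) atTop (𝓝 0) := by
    simpa using (tendsto_pow_atTop_nhds_zero_of_norm_lt_one hq).mul_const u
  suffices ContinuousAt (fun u => wpFactor q a u k) 0 from this.tendsto.comp h0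
  cases k with
  | ofNat k =>
    simp only [wpFactor]
    refine tendsto_finsetProd _ fun i _ => ?_
    refine ContinuousAt.div (by fun_prop) (by fun_prop) (by simp)
  | negSucc k =>
    simp only [wpFactor]
    refine tendsto_finsetProd _ fun i _ => ?_
    refine ContinuousAt.mul (by fun_prop) (ContinuousAt.div (by fun_prop) (by fun_prop) (by simp))

/-! ### Moments and the contiguous relation -/

/-- All the moments `∑ h k * q ^ (k * s)` with `-n ≤ s ≤ n + 2` converge absolutely. -/
def SummableMoments (q : ℂ) (h : ℤ → ℂ) (n : ℕ) : Prop :=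
  ∀ s : ℤ, -(n : ℤ) ≤ s → s ≤ n + 2 → Summable fun k : ℤ => h k * (q ^ k) ^ s

theorem SummableMoments.summable {q : ℂ} {h : ℤ → ℂ} {n : ℕ} (hs : SummableMoments q h n)
    (a : ℂ) : Summable fun k : ℤ => (1 - a * (q ^ k) ^ 2) * h k := by
  refine ((hs 0 (by omega) (by omega)).sub ((hs 2 (by omega) (by omega)).mul_left a)).congr
    fun k => ?_
  simp only [zpow_ofNat, pow_zero]
  ring

/-- The multiplier is 1 + au² - au q^k - u q^(-k), so it costs one moment at each end of the range.
-/
theorem SummableMoments.step {q : ℂ} (hq : q ≠ 0) {h : ℤ → ℂ} {n : ℕ}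
    (hs : SummableMoments q h (n + 1)) (a u : ℂ) :
    SummableMoments q (fun k => h k * ((q ^ k - u) * (1 - a * q ^ k * u) / q ^ k)) n := by
  intro s h1 h2
  refine (((hs s (by push_cast; omega) (by push_cast; omega)).mul_left (1 + a * u ^ 2)).sub
    (((hs (s + 1) (by push_cast; omega) (by push_cast; omega)).mul_left (a * u)).add
    ((hs (s - 1) (by push_cast; omega) (by push_cast; omega)).mul_left u))).congr fun k => ?_
  have hK : q ^ k ≠ 0 := zpow_ne_zero _ hq
  rw [zpow_add_one₀ hK, zpow_sub_one₀ hK]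
  field_simp
  ring

/-- The contiguous relation for bilateral very-well-poised series. -/
theorem contiguous_relation {q a u₁ u₂ u₃ u₄ : ℂ} (hq : q ≠ 0) {h : ℤ → ℂ}
    (hrec : ∀ k : ℤ, h (k + 1) * ((1 - a * q * u₁ * q ^ k) * (1 - a * q * u₂ * q ^ k)
        * (1 - a * q * u₃ * q ^ k) * (1 - a * q * u₄ * q ^ k))
      = q * a ^ 2 * (h k * ((u₁ - q ^ k) * (u₂ - q ^ k) * (u₃ - q ^ k) * (u₄ - q ^ k))))
    (hs : SummableMoments q h 1) :
    (1 - a ^ 2 * (u₁ * u₂ * u₃ * u₄)) *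
        ∑' k : ℤ, (1 - a * (q ^ k) ^ 2) * (h k * ((q ^ k - u₁) * (1 - a * q ^ k * u₁) / q ^ k))
      = (1 - a * u₁ * u₂) * (1 - a * u₁ * u₃) * (1 - a * u₁ * u₄)
        * ∑' k : ℤ, (1 - a * (q ^ k) ^ 2) * h k := by
  -- Telescoping certificate: by the recurrence, G (k+1) - G k is exactly the difference of the two
  -- summands. Expanded in powers of q^k, G uses the moments -1, …, 3.
  let G : ℤ → ℂ := fun k => u₁ * (h k * ((1 - a * q ^ k * u₁) * (1 - a * q ^ k * u₂)
    * (1 - a * q ^ k * u₃) * (1 - a * q ^ k * u₄) / q ^ k))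
  have hG : Summable G := by
    refine Summable.mul_left _ ?_
    have h0 := hs (-1) (by norm_num) (by norm_num)
    have h1 := (hs 0 (by norm_num) (by norm_num)).mul_left (-a * (u₁ + u₂ + u₃ + u₄))
    have h2 := (hs 1 (by norm_num) (by norm_num)).mul_left
      (a ^ 2 * (u₁ * u₂ + u₁ * u₃ + u₁ * u₄ + u₂ * u₃ + u₂ * u₄ + u₃ * u₄))
    have h3 := (hs 2 (by norm_num) (by norm_num)).mul_left
      (-a ^ 3 * (u₁ * u₂ * u₃ + u₁ * u₂ * u₄ + u₁ * u₃ * u₄ + u₂ * u₃ * u₄))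
    have h4 := (hs 3 (by norm_num) (by norm_num)).mul_left (a ^ 4 * (u₁ * u₂ * u₃ * u₄))
    refine ((((h0.add h1).add h2).add h3).add h4).congr fun k => ?_
    have hK : q ^ k ≠ 0 := zpow_ne_zero _ hq
    rw [zpow_neg_one, zpow_zero, zpow_one, zpow_ofNat, zpow_ofNat]
    field_simp
    ring
  have hshift : ∑' k, G (k + 1) = ∑' k, G k := (Equiv.addRight (1 : ℤ)).tsum_eq G
  have hG' : Summable fun k => G (k + 1) := (Equiv.addRight (1 : ℤ)).summable_iff.2 hG
  rw [← sub_eq_zero, ← tsum_mul_left, ← tsum_mul_left,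
    ← ((SummableMoments.step hq (n := 0) hs a u₁).summable a |>.mul_left _).tsum_sub
      ((hs.summable a).mul_left _), ← sub_eq_zero.2 hshift, ← hG'.tsum_sub hG]
  refine tsum_congr fun k => ?_
  have hK : q ^ k ≠ 0 := zpow_ne_zero _ hq
  have hr := hrec k
  simp only [G, zpow_add_one₀ hq]
  generalize q ^ k = K at *
  have e : h (k + 1) * ((1 - a * (K * q) * u₁) * (1 - a * (K * q) * u₂)
      * (1 - a * (K * q) * u₃) * (1 - a * (K * q) * u₄) / (K * q))
      = a ^ 2 * (h k * ((u₁ - K) * (u₂ - K) * (u₃ - K) * (u₄ - K))) / K := by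
    field_simp
    linear_combination hr
  rw [e]
  field_simp
  ring

/-! ### The four-parameter bilateral series: sending the parameters to zero -/

/-- The factors of a bilateral very-well-poised series other than `1 - a q ^ (2 k)`. -/
noncomputable def wpProd (q a u₁ u₂ u₃ u₄ : ℂ) (k : ℤ) : ℂ :=
  (q * a ^ 2) ^ k *
    (wpFactor q a u₁ k * wpFactor q a u₂ k * wpFactor q a u₃ k * wpFactor q a u₄ k)

/-- The bilateral very-well-poised series with four free parameters. -/
noncomputable def wpSum (q a u₁ u₂ u₃ u₄ : ℂ) : ℂ :=
  ∑' k : ℤ, (1 - a * (q ^ k) ^ 2) * wpProd q a u₁ u₂ u₃ u₄ k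

section

variable {q a u₁ u₂ u₃ u₄ : ℂ}

theorem wpProd_recurrence (hq : q ≠ 0) (ha : a ≠ 0) (h₁ : WPAdmissible q a u₁)
    (h₂ : WPAdmissible q a u₂) (h₃ : WPAdmissible q a u₃) (h₄ : WPAdmissible q a u₄) (k : ℤ) :
    wpProd q a u₁ u₂ u₃ u₄ (k + 1) * ((1 - a * q * u₁ * q ^ k) * (1 - a * q * u₂ * q ^ k)
        * (1 - a * q * u₃ * q ^ k) * (1 - a * q * u₄ * q ^ k))
      = q * a ^ 2 * (wpProd q a u₁ u₂ u₃ u₄ k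
        * ((u₁ - q ^ k) * (u₂ - q ^ k) * (u₃ - q ^ k) * (u₄ - q ^ k))) := by
  have hz : q * a ^ 2 ≠ 0 := by positivity
  simp only [wpProd, zpow_add_one₀ hz]
  calc _ = (q * a ^ 2) * (q * a ^ 2) ^ k
        * ((wpFactor q a u₁ (k + 1) * (1 - a * q * u₁ * q ^ k))
        * (wpFactor q a u₂ (k + 1) * (1 - a * q * u₂ * q ^ k))
        * (wpFactor q a u₃ (k + 1) * (1 - a * q * u₃ * q ^ k))
        * (wpFactor q a u₄ (k + 1) * (1 - a * q * u₄ * q ^ k))) := by ring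
    _ = _ := by
      rw [wpFactor_add_one hq h₁, wpFactor_add_one hq h₂, wpFactor_add_one hq h₃,
        wpFactor_add_one hq h₄]
      ring

theorem exists_bound_wpProd (hq0 : q ≠ 0) (hq : ‖q‖ < 1) (ha : a ≠ 0)
    (h₁ : WPAdmissible q a u₁) (h₂ : WPAdmissible q a u₂) (h₃ : WPAdmissible q a u₃)
    (h₄ : WPAdmissible q a u₄) {ρ₁ ρ₂ ρ₃ ρ₄ : ℝ} (p₁ : 0 < ρ₁) (p₂ : 0 < ρ₂) (p₃ : 0 < ρ₃)
    (p₄ : 0 < ρ₄) (l₁ : ‖u₁‖ ≤ ρ₁) (l₂ : ‖u₂‖ ≤ ρ₂) (l₃ : ‖u₃‖ ≤ ρ₃) (l₄ : ‖u₄‖ ≤ ρ₄) :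
    ∃ C : ℝ, 0 ≤ C ∧ ∀ m k : ℕ,
      ‖wpProd q a (q ^ m * u₁) u₂ u₃ u₄ k‖ ≤ C * (‖q‖ * ‖a‖ ^ 2 * (ρ₁ * ρ₂ * ρ₃ * ρ₄)) ^ k ∧
      ‖wpProd q a (q ^ m * u₁) u₂ u₃ u₄ (-k)‖
        ≤ C * (‖q‖ * ‖a‖ ^ 2 * (ρ₁ * ρ₂ * ρ₃ * ρ₄) * ‖q‖ ^ 2) ^ k := by
  obtain ⟨C₁, n₁, b₁⟩ := exists_bound_wpFactor hq0 hq ha h₁ p₁ l₁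
  obtain ⟨C₂, n₂, b₂⟩ := exists_bound_wpFactor hq0 hq ha h₂ p₂ l₂
  obtain ⟨C₃, n₃, b₃⟩ := exists_bound_wpFactor hq0 hq ha h₃ p₃ l₃
  obtain ⟨C₄, n₄, b₄⟩ := exists_bound_wpFactor hq0 hq ha h₄ p₄ l₄
  refine ⟨C₁ * C₂ * C₃ * C₄, by positivity, fun m k => ?_⟩
  have b₁ := b₁ m k
  have b₂ := b₂ 0 k
  have b₃ := b₃ 0 k
  have b₄ := b₄ 0 k
  simp only [pow_zero, one_mul] at b₂ b₃ b₄
  have hqn : ‖q‖ ≠ 0 := norm_ne_zero_iff.2 hq0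
  have han : ‖a‖ ≠ 0 := norm_ne_zero_iff.2 ha
  constructor
  · calc _ = (‖q‖ * ‖a‖ ^ 2) ^ k * (‖wpFactor q a (q ^ m * u₁) k‖ * ‖wpFactor q a u₂ k‖
          * ‖wpFactor q a u₃ k‖ * ‖wpFactor q a u₄ k‖) := by
          simp only [wpProd, norm_mul, norm_pow, zpow_natCast]
      _ ≤ (‖q‖ * ‖a‖ ^ 2) ^ k *
          ((C₁ * ρ₁ ^ k) * (C₂ * ρ₂ ^ k) * (C₃ * ρ₃ ^ k) * (C₄ * ρ₄ ^ k)) := by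
          gcongr
          exacts [b₁.1, b₂.1, b₃.1, b₄.1]
      _ = _ := by simp only [mul_pow]; ring
  · calc _ = ((‖q‖ * ‖a‖ ^ 2)⁻¹) ^ k * (‖wpFactor q a (q ^ m * u₁) (-k)‖
          * ‖wpFactor q a u₂ (-k)‖ * ‖wpFactor q a u₃ (-k)‖ * ‖wpFactor q a u₄ (-k)‖) := by
          simp only [wpProd, norm_mul, zpow_neg, norm_inv, zpow_natCast, norm_pow,
            inv_pow]
      _ ≤ ((‖q‖ * ‖a‖ ^ 2)⁻¹) ^ k * ((C₁ * (‖q‖ * ‖a‖ * ρ₁) ^ k) * (C₂ * (‖q‖ * ‖a‖ * ρ₂) ^ k)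
          * (C₃ * (‖q‖ * ‖a‖ * ρ₃) ^ k) * (C₄ * (‖q‖ * ‖a‖ * ρ₄) ^ k)) := by
          gcongr
          exacts [b₁.2, b₂.2, b₃.2, b₄.2]
      _ = C₁ * C₂ * C₃ * C₄ * ((‖q‖ * ‖a‖ ^ 2)⁻¹ * ((‖q‖ * ‖a‖ * ρ₁) * (‖q‖ * ‖a‖ * ρ₂)
          * (‖q‖ * ‖a‖ * ρ₃) * (‖q‖ * ‖a‖ * ρ₄))) ^ k := by
          rw [mul_pow (‖q‖ * ‖a‖ ^ 2)⁻¹, mul_pow _ (‖q‖ * ‖a‖ * ρ₄),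
            mul_pow _ (‖q‖ * ‖a‖ * ρ₃), mul_pow _ (‖q‖ * ‖a‖ * ρ₂)]
          ring
      _ = _ := by congr 2; field_simp

theorem summableMoments_wpProd (hq0 : q ≠ 0) (hq : ‖q‖ < 1) (ha : a ≠ 0)
    (h₁ : WPAdmissible q a u₁) (h₂ : WPAdmissible q a u₂) (h₃ : WPAdmissible q a u₃)
    (h₄ : WPAdmissible q a u₄) {ρ₁ ρ₂ ρ₃ ρ₄ : ℝ} (p₁ : 0 < ρ₁) (p₂ : 0 < ρ₂) (p₃ : 0 < ρ₃)
    (p₄ : 0 < ρ₄) (l₁ : ‖u₁‖ ≤ ρ₁) (l₂ : ‖u₂‖ ≤ ρ₂) (l₃ : ‖u₃‖ ≤ ρ₃) (l₄ : ‖u₄‖ ≤ ρ₄) {n : ℕ}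
    (hr : ‖q‖ * ‖a‖ ^ 2 * (ρ₁ * ρ₂ * ρ₃ * ρ₄) < ‖q‖ ^ n) :
    SummableMoments q (wpProd q a u₁ u₂ u₃ u₄) n := by
  obtain ⟨C, hC0, hC⟩ := exists_bound_wpProd hq0 hq ha h₁ h₂ h₃ h₄ p₁ p₂ p₃ p₄ l₁ l₂ l₃ l₄
  have hqn : 0 < ‖q‖ := norm_pos_iff.2 hq0
  set r := ‖q‖ * ‖a‖ ^ 2 * (ρ₁ * ρ₂ * ρ₃ * ρ₄) with hrdef
  have hr0 : 0 ≤ r := by positivity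
  have key : ∀ t : ℤ, -(n : ℤ) ≤ t → r * ‖q‖ ^ t < 1 := fun t ht => by
    calc r * ‖q‖ ^ t < ‖q‖ ^ n * ‖q‖ ^ t := by gcongr
      _ = ‖q‖ ^ ((n : ℤ) + t) := by rw [zpow_add₀ hqn.ne', zpow_natCast]
      _ ≤ 1 := by
        lift (n : ℤ) + t to ℕ using by omega with N
        rw [zpow_natCast]
        exact pow_le_one₀ hqn.le hq.le
  have h0 : ∀ k : ℕ, ‖wpProd q a u₁ u₂ u₃ u₄ k‖ ≤ C * r ^ k ∧
      ‖wpProd q a u₁ u₂ u₃ u₄ (-k)‖ ≤ C * (r * ‖q‖ ^ 2) ^ k := by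
    simpa using hC 0
  intro s hs1 hs2
  refine Summable.of_nat_of_neg ?_ ?_
  · refine Summable.of_norm_bounded
      ((summable_geometric_of_lt_one (by positivity) (key s hs1)).mul_left C) fun k => ?_
    calc _ = ‖wpProd q a u₁ u₂ u₃ u₄ k‖ * (‖q‖ ^ s) ^ k := by
          simp only [norm_mul, norm_zpow]
          rw [← zpow_mul, ← zpow_natCast (‖q‖ ^ s), ← zpow_mul, mul_comm s]
      _ ≤ (C * r ^ k) * (‖q‖ ^ s) ^ k := by gcongr; exact (h0 k).1
      _ = _ := by rw [mul_pow]; ring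
  · refine Summable.of_norm_bounded
      ((summable_geometric_of_lt_one (by positivity) (key (2 - s) (by omega))).mul_left C)
      fun k => ?_
    calc _ = ‖wpProd q a u₁ u₂ u₃ u₄ (-k)‖ * (‖q‖ ^ (-s)) ^ k := by
          simp only [norm_mul, norm_zpow]
          rw [← zpow_mul, ← zpow_natCast (‖q‖ ^ (-s)), ← zpow_mul]
          congr 2
          ring
      _ ≤ (C * (r * ‖q‖ ^ 2) ^ k) * (‖q‖ ^ (-s)) ^ k := by gcongr; exact (h0 k).2
      _ = _ := by
          rw [sub_eq_add_neg, zpow_add₀ hqn.ne', zpow_ofNat, ← mul_assoc r, mul_pow (r * _)]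
          ring

theorem wpSum_mul_q (hq0 : q ≠ 0) (hq : ‖q‖ < 1) (ha : a ≠ 0)
    (h₁ : WPAdmissible q a u₁) (h₂ : WPAdmissible q a u₂) (h₃ : WPAdmissible q a u₃)
    (h₄ : WPAdmissible q a u₄) {ρ₁ ρ₂ ρ₃ ρ₄ : ℝ} (p₁ : 0 < ρ₁) (p₂ : 0 < ρ₂) (p₃ : 0 < ρ₃)
    (p₄ : 0 < ρ₄) (l₁ : ‖u₁‖ ≤ ρ₁) (l₂ : ‖u₂‖ ≤ ρ₂) (l₃ : ‖u₃‖ ≤ ρ₃) (l₄ : ‖u₄‖ ≤ ρ₄)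
    (hr : ‖q‖ * ‖a‖ ^ 2 * (ρ₁ * ρ₂ * ρ₃ * ρ₄) < 1) :
    (1 - q * a ^ 2 * (u₁ * u₂ * u₃ * u₄)) * ((1 - q * u₁) * (1 - a * q * u₁)
        * wpSum q a u₁ u₂ u₃ u₄)
      = (1 - a * q * u₁ * u₂) * (1 - a * q * u₁ * u₃) * (1 - a * q * u₁ * u₄)
        * wpSum q a (q * u₁) u₂ u₃ u₄ := by
  have hqn : 0 < ‖q‖ := norm_pos_iff.2 hq0
  have h₁' : WPAdmissible q a (q * u₁) := by simpa using h₁.mul_pow 1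
  -- Applied at q u₁: bounding this parameter by ‖q‖ρ₁ gains the factor ‖q‖ that pays for the extra
  -- moment.
  have hc := contiguous_relation hq0 (wpProd_recurrence hq0 ha h₁' h₂ h₃ h₄)
    (summableMoments_wpProd hq0 hq ha h₁' h₂ h₃ h₄ (mul_pos hqn p₁) p₂ p₃ p₄
      (by rw [norm_mul]; gcongr) l₂ l₃ l₄ (n := 1) (by
        rw [pow_one]
        calc _ = ‖q‖ * (‖q‖ * ‖a‖ ^ 2 * (ρ₁ * ρ₂ * ρ₃ * ρ₄)) := by ring
          _ < ‖q‖ * 1 := by gcongr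
          _ = _ := mul_one _))
  have e : ∀ k : ℤ, wpProd q a (q * u₁) u₂ u₃ u₄ k *
      ((q ^ k - q * u₁) * (1 - a * q ^ k * (q * u₁)) / q ^ k)
      = (1 - q * u₁) * (1 - a * q * u₁) * wpProd q a u₁ u₂ u₃ u₄ k := fun k => by
    simp only [wpProd]
    linear_combination (q * a ^ 2) ^ k * (wpFactor q a u₂ k * wpFactor q a u₃ k
      * wpFactor q a u₄ k) * wpFactor_mul_q hq0 h₁ k
  simp only [e] at hc
  rw [wpSum, wpSum, ← tsum_mul_left]
  convert hc using 1
  · congr 1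
    · ring
    · exact tsum_congr fun k => by ring
  · ring

theorem wpSum_mul_pow (hq0 : q ≠ 0) (hq : ‖q‖ < 1) (ha : a ≠ 0)
    (h₁ : WPAdmissible q a u₁) (h₂ : WPAdmissible q a u₂) (h₃ : WPAdmissible q a u₃)
    (h₄ : WPAdmissible q a u₄) {ρ₁ ρ₂ ρ₃ ρ₄ : ℝ} (p₁ : 0 < ρ₁) (p₂ : 0 < ρ₂) (p₃ : 0 < ρ₃)
    (p₄ : 0 < ρ₄) (l₁ : ‖u₁‖ ≤ ρ₁) (l₂ : ‖u₂‖ ≤ ρ₂) (l₃ : ‖u₃‖ ≤ ρ₃) (l₄ : ‖u₄‖ ≤ ρ₄)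
    (hr : ‖q‖ * ‖a‖ ^ 2 * (ρ₁ * ρ₂ * ρ₃ * ρ₄) < 1) (m : ℕ) :
    qShift (q * a ^ 2 * (u₁ * u₂ * u₃ * u₄)) q m * (qShift (q * u₁) q m
        * qShift (a * q * u₁) q m * wpSum q a u₁ u₂ u₃ u₄)
      = qShift (a * q * u₁ * u₂) q m * qShift (a * q * u₁ * u₃) q m
        * qShift (a * q * u₁ * u₄) q m * wpSum q a (q ^ m * u₁) u₂ u₃ u₄ := by
  induction m with
  | zero => simp [qShift_zero]
  | succ m ih =>
    have hm : ‖q ^ m * u₁‖ ≤ ρ₁ := by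
      rw [norm_mul, norm_pow]
      exact (mul_le_of_le_one_left (norm_nonneg _) (pow_le_one₀ (norm_nonneg _) hq.le)).trans l₁
    have hc := wpSum_mul_q hq0 hq ha (h₁.mul_pow m) h₂ h₃ h₄ p₁ p₂ p₃ p₄ hm l₂ l₃ l₄ hr
    rw [← mul_assoc q, ← pow_succ' q m] at hc
    simp only [qShift_succ]
    linear_combination (1 - q * a ^ 2 * (u₁ * u₂ * u₃ * u₄) * q ^ m) * (1 - q * u₁ * q ^ m)
      * (1 - a * q * u₁ * q ^ m) * ih + qShift (a * q * u₁ * u₂) q m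
      * qShift (a * q * u₁ * u₃) q m * qShift (a * q * u₁ * u₄) q m * hc

theorem tendsto_wpSum (hq0 : q ≠ 0) (hq : ‖q‖ < 1) (ha : a ≠ 0)
    (h₁ : WPAdmissible q a u₁) (h₂ : WPAdmissible q a u₂) (h₃ : WPAdmissible q a u₃)
    (h₄ : WPAdmissible q a u₄) {ρ₁ ρ₂ ρ₃ ρ₄ : ℝ} (p₁ : 0 < ρ₁) (p₂ : 0 < ρ₂) (p₃ : 0 < ρ₃)
    (p₄ : 0 < ρ₄) (l₁ : ‖u₁‖ ≤ ρ₁) (l₂ : ‖u₂‖ ≤ ρ₂) (l₃ : ‖u₃‖ ≤ ρ₃) (l₄ : ‖u₄‖ ≤ ρ₄)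
    (hr : ‖q‖ * ‖a‖ ^ 2 * (ρ₁ * ρ₂ * ρ₃ * ρ₄) < 1) :
    Tendsto (fun m : ℕ => wpSum q a (q ^ m * u₁) u₂ u₃ u₄) atTop
      (𝓝 (wpSum q a 0 u₂ u₃ u₄)) := by
  obtain ⟨C, hC0, hC⟩ := exists_bound_wpProd hq0 hq ha h₁ h₂ h₃ h₄ p₁ p₂ p₃ p₄ l₁ l₂ l₃ l₄
  have hqn : 0 < ‖q‖ := norm_pos_iff.2 hq0
  set r := ‖q‖ * ‖a‖ ^ 2 * (ρ₁ * ρ₂ * ρ₃ * ρ₄) with hrdef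
  have hr0 : 0 ≤ r := by positivity
  have hgeo : Summable fun k : ℕ => (1 + ‖a‖) * C * r ^ k :=
    (summable_geometric_of_lt_one hr0 hr).mul_left _
  refine tendsto_tsum_of_dominated_convergence
    (bound := fun k : ℤ => (1 + ‖a‖) * C * r ^ k.natAbs)
    (Summable.of_nat_of_neg (by simpa using hgeo) (by simpa using hgeo)) (fun k => ?_)
    (Eventually.of_forall fun m k => ?_)
  · refine Tendsto.const_mul _ (Tendsto.const_mul _ ?_)
    exact (((tendsto_wpFactor hq a u₁ k).mul_const _).mul_const _).mul_const _
  · have hle : ∀ t : ℝ, 0 ≤ t → t ≤ 1 → 1 + ‖a‖ * t ≤ 1 + ‖a‖ := fun t _ h1 => by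
      have := mul_le_of_le_one_right (norm_nonneg a) h1
      linarith
    rcases Int.eq_nat_or_neg k with ⟨n, rfl | rfl⟩
    · rw [norm_mul, Int.natAbs_natCast, mul_assoc]
      gcongr
      · refine (norm_sub_le _ _).trans ?_
        rw [norm_one, norm_mul, zpow_natCast, norm_pow, norm_pow]
        exact hle _ (by positivity) (pow_le_one₀ (by positivity)
          (pow_le_one₀ (norm_nonneg _) hq.le))
      · exact (hC m n).1
    · rw [norm_mul, Int.natAbs_neg, Int.natAbs_natCast]
      -- For negative indices 1 - a q^(2k) grows like ‖q‖^(-2n); the factor (‖q‖²)^n in the bound on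
      -- `wpProd` absorbs exactly this.
      have e : ‖1 - a * (q ^ (-(n : ℤ))) ^ 2‖ ≤ (1 + ‖a‖) * ((‖q‖ ^ 2) ^ n)⁻¹ := by
        refine (norm_sub_le _ _).trans ?_
        have h1 : 1 ≤ ((‖q‖ ^ 2) ^ n)⁻¹ := by
          rw [one_le_inv₀ (by positivity)]
          exact pow_le_one₀ (by positivity) (pow_le_one₀ (norm_nonneg _) hq.le)
        rw [norm_one, norm_mul, zpow_neg, zpow_natCast, norm_pow, norm_inv, norm_pow, inv_pow,
          ← pow_mul, mul_comm n, pow_mul]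
        linarith
      calc _ ≤ ((1 + ‖a‖) * ((‖q‖ ^ 2) ^ n)⁻¹) * (C * (r * ‖q‖ ^ 2) ^ n) := by
            gcongr
            exact (hC m n).2
        _ = _ := by rw [mul_pow r]; field_simp

theorem wpSum_eq_zero_left (hq0 : q ≠ 0) (hq : ‖q‖ < 1) (ha : a ≠ 0)
    (h₁ : WPAdmissible q a u₁) (h₂ : WPAdmissible q a u₂) (h₃ : WPAdmissible q a u₃)
    (h₄ : WPAdmissible q a u₄) {ρ₁ ρ₂ ρ₃ ρ₄ : ℝ} (p₁ : 0 < ρ₁) (p₂ : 0 < ρ₂) (p₃ : 0 < ρ₃)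
    (p₄ : 0 < ρ₄) (l₁ : ‖u₁‖ ≤ ρ₁) (l₂ : ‖u₂‖ ≤ ρ₂) (l₃ : ‖u₃‖ ≤ ρ₃) (l₄ : ‖u₄‖ ≤ ρ₄)
    (hr : ‖q‖ * ‖a‖ ^ 2 * (ρ₁ * ρ₂ * ρ₃ * ρ₄) < 1) :
    qShiftInf (q * a ^ 2 * (u₁ * u₂ * u₃ * u₄)) q * (qShiftInf (q * u₁) q
        * qShiftInf (a * q * u₁) q * wpSum q a u₁ u₂ u₃ u₄)
      = qShiftInf (a * q * u₁ * u₂) q * qShiftInf (a * q * u₁ * u₃) q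
        * qShiftInf (a * q * u₁ * u₄) q * wpSum q a 0 u₂ u₃ u₄ := by
  refine tendsto_nhds_unique ((tendsto_qShift hq _).mul (((tendsto_qShift hq _).mul
    (tendsto_qShift hq _)).mul_const _)) ?_
  simp only [wpSum_mul_pow hq0 hq ha h₁ h₂ h₃ h₄ p₁ p₂ p₃ p₄ l₁ l₂ l₃ l₄ hr]
  exact (((tendsto_qShift hq _).mul (tendsto_qShift hq _)).mul (tendsto_qShift hq _)).mul
    (tendsto_wpSum hq0 hq ha h₁ h₂ h₃ h₄ p₁ p₂ p₃ p₄ l₁ l₂ l₃ l₄ hr)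

theorem wpSum_rotate : wpSum q a u₁ u₂ u₃ u₄ = wpSum q a u₂ u₃ u₄ u₁ :=
  tsum_congr fun k => by simp only [wpProd]; ring

/-- Reduction of the bilateral series to the case where all parameters vanish. -/
theorem wpSum_eq_zero (hq0 : q ≠ 0) (hq : ‖q‖ < 1) (ha : a ≠ 0)
    (h₁ : WPAdmissible q a u₁) (h₂ : WPAdmissible q a u₂) (h₃ : WPAdmissible q a u₃)
    (h₄ : WPAdmissible q a u₄) {ρ₁ ρ₂ ρ₃ ρ₄ : ℝ} (p₁ : 0 < ρ₁) (p₂ : 0 < ρ₂) (p₃ : 0 < ρ₃)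
    (p₄ : 0 < ρ₄) (l₁ : ‖u₁‖ ≤ ρ₁) (l₂ : ‖u₂‖ ≤ ρ₂) (l₃ : ‖u₃‖ ≤ ρ₃) (l₄ : ‖u₄‖ ≤ ρ₄)
    (hr : ‖q‖ * ‖a‖ ^ 2 * (ρ₁ * ρ₂ * ρ₃ * ρ₄) < 1) :
    qShiftInf (q * a ^ 2 * (u₁ * u₂ * u₃ * u₄)) q
        * (qShiftInf (q * u₁) q * qShiftInf (q * u₂) q * qShiftInf (q * u₃) q
          * qShiftInf (q * u₄) q)
        * (qShiftInf (a * q * u₁) q * qShiftInf (a * q * u₂) q * qShiftInf (a * q * u₃) q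
          * qShiftInf (a * q * u₄) q) * wpSum q a u₁ u₂ u₃ u₄
      = qShiftInf (a * q * u₁ * u₂) q * qShiftInf (a * q * u₁ * u₃) q
        * qShiftInf (a * q * u₁ * u₄) q * qShiftInf (a * q * u₂ * u₃) q
        * qShiftInf (a * q * u₂ * u₄) q * qShiftInf (a * q * u₃ * u₄) q
        * wpSum q a 0 0 0 0 := by
  have z := WPAdmissible.zero q a
  have e₁ := wpSum_eq_zero_left hq0 hq ha h₁ h₂ h₃ h₄ p₁ p₂ p₃ p₄ l₁ l₂ l₃ l₄ hr
  -- The parameters are rotated so that the next nonzero one comes first. Those already sent to 0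
  -- keep their positive bounds ρᵢ, so the smallness condition never changes.
  have e₂ := wpSum_eq_zero_left hq0 hq ha h₂ h₃ h₄ z p₂ p₃ p₄ p₁ l₂ l₃ l₄ (by simpa using p₁.le)
    (by convert hr using 2; ring)
  have e₃ := wpSum_eq_zero_left hq0 hq ha h₃ h₄ z z p₃ p₄ p₁ p₂ l₃ l₄ (by simpa using p₁.le)
    (by simpa using p₂.le) (by convert hr using 2; ring)
  have e₄ := wpSum_eq_zero_left hq0 hq ha h₄ z z z p₄ p₁ p₂ p₃ l₄ (by simpa using p₁.le)
    (by simpa using p₂.le) (by simpa using p₃.le) (by convert hr using 2; ring)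
  rw [← wpSum_rotate] at e₂ e₃ e₄
  simp only [mul_zero, qShiftInf_zero_left, one_mul, mul_one] at e₂ e₃ e₄
  linear_combination (qShiftInf (q * u₂) q * qShiftInf (a * q * u₂) q)
      * (qShiftInf (q * u₃) q * qShiftInf (a * q * u₃) q)
      * (qShiftInf (q * u₄) q * qShiftInf (a * q * u₄) q) * e₁
    + (qShiftInf (a * q * u₁ * u₂) q * qShiftInf (a * q * u₁ * u₃) q
        * qShiftInf (a * q * u₁ * u₄) q)
      * ((qShiftInf (q * u₃) q * qShiftInf (a * q * u₃) q)
      * (qShiftInf (q * u₄) q * qShiftInf (a * q * u₄) q) * e₂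
      + (qShiftInf (a * q * u₂ * u₃) q * qShiftInf (a * q * u₂ * u₄) q)
        * (qShiftInf (q * u₄) q * qShiftInf (a * q * u₄) q * e₃
          + qShiftInf (a * q * u₃ * u₄) q * e₄))

end

/-! ### The Jacobi triple product and Bailey's sum -/

/-- The factor itself is (-1)^k q^(k(k-1)/2); only its fourth power occurs in the parameter-free
series, and there the sign and the halved exponent disappear. -/
theorem wpFactor_zero_right_pow_four {q : ℂ} (hq : q ≠ 0) (a : ℂ) (k : ℤ) :
    wpFactor q a 0 k ^ 4 = q ^ (2 * k * (k - 1)) := by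
  refine eq_of_recurrence (F := fun k => wpFactor q a 0 k ^ 4)
    (G := fun k => q ^ (2 * k * (k - 1))) (α := fun _ => 1) (β := fun k => (q ^ k) ^ 4)
    (fun _ => one_ne_zero) (fun n => pow_ne_zero _ (zpow_ne_zero _ hq)) (fun k => ?_)
    (fun k => ?_) (by simp [wpFactor_zero]) k
  · have h := wpFactor_add_one hq (WPAdmissible.zero q a) k
    simp only [mul_zero, zero_mul, sub_zero, mul_one, zero_sub] at h ⊢
    rw [h]
    ring
  · rw [mul_one, ← zpow_natCast (q ^ k), ← zpow_mul, ← zpow_add₀ hq]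
    congr 1
    push_cast
    ring

/-- For a = q^j each term is a difference of two powers of q that the reflection k ↦ -j - k
exchanges, so the sum equals its own negative. This covers the values of a for which 1 or 1/a is not
an admissible parameter. -/
theorem wpSum_zero_of_zpow {q : ℂ} (hq : q ≠ 0) (j : ℤ) : wpSum q (q ^ j) 0 0 0 0 = 0 := by
  have ht : ∀ k : ℤ, (1 - q ^ j * (q ^ k) ^ 2) * wpProd q (q ^ j) 0 0 0 0 k
      = q ^ (2 * k ^ 2 - k + 2 * j * k) - q ^ (2 * k ^ 2 + k + 2 * j * k + j) := fun k => by
    have e : wpProd q (q ^ j) 0 0 0 0 k = q ^ (2 * k ^ 2 - k + 2 * j * k) := by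
      have h4 := wpFactor_zero_right_pow_four hq (q ^ j) k
      calc _ = (q * (q ^ j) ^ 2) ^ k * wpFactor q (q ^ j) 0 k ^ 4 := by
            simp only [wpProd]; ring
        _ = (q ^ (1 + j * 2)) ^ k * q ^ (2 * k * (k - 1)) := by
            rw [h4, zpow_add₀ hq, zpow_one, zpow_mul q j 2, zpow_ofNat]
        _ = _ := by
            rw [← zpow_mul, ← zpow_add₀ hq]
            congr 1
            ring
    rw [e, ← zpow_natCast (q ^ k), ← zpow_mul, ← zpow_add₀ hq, sub_mul, one_mul,
      ← zpow_add₀ hq]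
    congr 2
    push_cast
    ring
  have hneg : wpSum q (q ^ j) 0 0 0 0 = -wpSum q (q ^ j) 0 0 0 0 := by
    simp only [wpSum, ht]
    rw [← tsum_neg, ← (Equiv.subLeft (-j)).tsum_eq]
    refine tsum_congr fun k => ?_
    rw [neg_sub, Equiv.subLeft_apply]
    congr 2 <;> ring
  exact self_eq_neg.1 hneg

theorem pow_succ_ne_one {q : ℂ} (hq : ‖q‖ < 1) (i : ℕ) : q * q ^ i ≠ 1 := fun h => by
  have := congrArg norm h
  rw [← pow_succ', norm_pow, norm_one] at this
  exact (pow_lt_one₀ (norm_nonneg _) hq i.succ_ne_zero).ne this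

/-- The parameter 1 kills all terms with k > 0 and the parameter 1/a all those with k < 0. -/
theorem wpSum_terminating {q a : ℂ} (ha : a ≠ 0) : wpSum q a 1 a⁻¹ 0 0 = 1 - a := by
  rw [wpSum, tsum_eq_single 0]
  · simp [wpProd, wpFactor_zero]
  · intro k hk
    have : wpFactor q a 1 k = 0 ∨ wpFactor q a a⁻¹ k = 0 := by
      rcases Int.eq_nat_or_neg k with ⟨n, rfl | rfl⟩
      · left
        rw [wpFactor_natCast]
        exact Finset.prod_eq_zero (i := 0) (Finset.mem_range.2 (by omega)) (by simp)
      · right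
        rw [wpFactor_neg]
        exact Finset.prod_eq_zero (i := 0) (Finset.mem_range.2 (by omega)) (by simp [ha])
    rcases this with h | h <;> simp [wpProd, h]

/-- The Jacobi triple product, in the form of a very-well-poised series without parameters. -/
theorem wpSum_zero {q a : ℂ} (hq0 : q ≠ 0) (hq : ‖q‖ < 1) (ha : a ≠ 0) :
    wpSum q a 0 0 0 0 = qShiftInf q q * qShiftInf a q * qShiftInf (q / a) q := by
  -- At the integer powers of q excluded by these two case distinctions, a factor of the right side
  -- has a zero and the left side vanishes by antisymmetry.
  by_cases h1 : ∃ i : ℕ, a * q * q ^ i = 1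
  · obtain ⟨i, hi⟩ := h1
    have e : a = q ^ (-((i : ℤ) + 1)) := by
      rw [zpow_neg, zpow_add_one₀ hq0, zpow_natCast]
      exact eq_inv_of_mul_eq_one_left (by rw [← hi]; ring)
    rw [qShiftInf_eq_zero hq (x := a) (i := i + 1) (by rw [← hi]; ring), e,
      wpSum_zero_of_zpow hq0, mul_zero, zero_mul]
  by_cases h2 : ∃ i : ℕ, q / a * q ^ i = 1
  · obtain ⟨i, hi⟩ := h2
    have e : a = q ^ ((i : ℤ) + 1) := by
      rw [zpow_add_one₀ hq0, zpow_natCast]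
      field_simp at hi
      rw [← hi]; ring
    rw [qShiftInf_eq_zero hq hi, e, wpSum_zero_of_zpow hq0, mul_zero]
  push Not at h1 h2
  have han : 0 < ‖a‖ := norm_pos_iff.2 ha
  have z := WPAdmissible.zero q a
  have hA : WPAdmissible q a 1 := ⟨by simpa using h1, by simpa using pow_succ_ne_one hq⟩
  have hB : WPAdmissible q a a⁻¹ :=
    ⟨fun i => by
      have e : a * q * a⁻¹ * q ^ i = q * q ^ i := by field_simp
      rw [e]
      exact pow_succ_ne_one hq i, by simpa [div_eq_mul_inv] using h2⟩
  -- The parameters 1 and 1/a alone give ‖q‖‖a‖, which may exceed 1. The third parameter is 0, so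
  -- its bound may be taken this small to force convergence.
  have hp : 0 < (‖q‖ * ‖a‖ + 1)⁻¹ := by positivity
  have key := wpSum_eq_zero hq0 hq ha hA hB z z one_pos (inv_pos.2 han) hp one_pos (by simp)
    (by simp) (by simpa using hp.le) (by simp) (by
      have : ‖q‖ * ‖a‖ ^ 2 * (1 * ‖a‖⁻¹ * (‖q‖ * ‖a‖ + 1)⁻¹ * 1)
          = ‖q‖ * ‖a‖ / (‖q‖ * ‖a‖ + 1) := by field_simp
      rw [this, div_lt_one (by positivity)]
      linarith)
  have e1 : a * q * a⁻¹ = q := by field_simp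
  simp only [mul_one, mul_zero, qShiftInf_zero_left, one_mul, wpSum_terminating ha, e1] at key
  have hne : qShiftInf q q ≠ 0 := qShiftInf_ne_zero hq (pow_succ_ne_one hq)
  rw [qShiftInf_eq_mul hq a, div_eq_mul_inv]
  refine mul_left_cancel₀ hne ?_
  rw [← key]
  ring

/-- Bailey's sum of a bilateral very-well-poised series. -/
theorem wpSum_eq {q a u₁ u₂ u₃ u₄ : ℂ} (hq0 : q ≠ 0) (hq : ‖q‖ < 1) (ha : a ≠ 0)
    (h₁ : WPAdmissible q a u₁) (h₂ : WPAdmissible q a u₂) (h₃ : WPAdmissible q a u₃)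
    (h₄ : WPAdmissible q a u₄) (n₁ : u₁ ≠ 0) (n₂ : u₂ ≠ 0) (n₃ : u₃ ≠ 0) (n₄ : u₄ ≠ 0)
    (hr : ‖q * a ^ 2 * (u₁ * u₂ * u₃ * u₄)‖ < 1) :
    wpSum q a u₁ u₂ u₃ u₄ =
      qShiftInf q q * qShiftInf a q * qShiftInf (q / a) q * (qShiftInf (a * q * u₁ * u₂) q
        * qShiftInf (a * q * u₁ * u₃) q * qShiftInf (a * q * u₁ * u₄) q
        * qShiftInf (a * q * u₂ * u₃) q * qShiftInf (a * q * u₂ * u₄) q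
        * qShiftInf (a * q * u₃ * u₄) q)
      / (qShiftInf (q * a ^ 2 * (u₁ * u₂ * u₃ * u₄)) q
        * (qShiftInf (q * u₁) q * qShiftInf (q * u₂) q * qShiftInf (q * u₃) q
          * qShiftInf (q * u₄) q)
        * (qShiftInf (a * q * u₁) q * qShiftInf (a * q * u₂) q * qShiftInf (a * q * u₃) q
          * qShiftInf (a * q * u₄) q)) := by
  have key := wpSum_eq_zero hq0 hq ha h₁ h₂ h₃ h₄ (norm_pos_iff.2 n₁) (norm_pos_iff.2 n₂)
    (norm_pos_iff.2 n₃) (norm_pos_iff.2 n₄) le_rfl le_rfl le_rfl le_rfl (by simpa using hr)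
  have hU : qShiftInf (q * a ^ 2 * (u₁ * u₂ * u₃ * u₄)) q ≠ 0 := by
    refine qShiftInf_ne_zero hq fun i h => ?_
    have := congrArg norm h
    rw [norm_mul, norm_pow, norm_one] at this
    have := mul_le_of_le_one_right (norm_nonneg (q * a ^ 2 * (u₁ * u₂ * u₃ * u₄)))
      (pow_le_one₀ (norm_nonneg q) hq.le (n := i))
    linarith
  have k₁ := qShiftInf_ne_zero hq h₁.1
  have k₂ := qShiftInf_ne_zero hq h₂.1
  have k₃ := qShiftInf_ne_zero hq h₃.1
  have k₄ := qShiftInf_ne_zero hq h₄.1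
  have l₁ := qShiftInf_ne_zero hq h₁.2
  have l₂ := qShiftInf_ne_zero hq h₂.2
  have l₃ := qShiftInf_ne_zero hq h₃.2
  have l₄ := qShiftInf_ne_zero hq h₄.2
  rw [eq_div_iff (by simp only [ne_eq, mul_eq_zero, not_or]; tauto)]
  rw [wpSum_zero hq0 hq ha] at key
  linear_combination key

/-! ### The `q`-Pfaff–Saalschütz sum -/

theorem qShift_self_ne_zero {q : ℂ} (hq : ‖q‖ < 1) (n : ℕ) : qShift q q n ≠ 0 :=
  qShift_ne_zero fun i _ => pow_succ_ne_one hq i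

/-- The `q`-Pfaff–Saalschütz sum, without negative powers of `q`. -/
theorem sum_antidiagonal_saalschutz {q : ℂ} (hq0 : q ≠ 0) (hq : ‖q‖ < 1) (A B D : ℂ) (n : ℕ)
    (hC : ∀ j < n, D * A * B * q ^ j ≠ 1) :
    qShift (D * A) q n * qShift (D * B) q n = ∑ x ∈ Finset.HasAntidiagonal.antidiagonal n,
      qShift q q n / (qShift q q x.1 * qShift q q x.2) * qShift (D * A * B * q ^ x.1) q x.2
        * qShift D q x.2 * D ^ x.1 * (qShift A q x.1 * qShift B q x.1) := by
  induction n with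
  | zero => simp [qShift_zero]
  | succ n ih =>
    set C := D * A * B with hCdef
    let F : ℕ → ℕ → ℕ → ℂ := fun n j m => qShift q q n / (qShift q q j * qShift q q m)
      * qShift (C * q ^ j) q m * qShift D q m * D ^ j * (qShift A q j * qShift B q j)
    -- The weights in X and Y add up to 1 on the antidiagonal j + m = n + 1. X vanishes at m = 0 and
    -- Y at j = 0; after shifting m in X and j in Y, both become multiples of F n j m, whose
    -- multipliers add up to (1 - DAq^n)(1 - DBq^n), independent of j.
    let X : ℕ × ℕ → ℂ := fun x => F (n + 1) x.1 x.2 * ((1 - q ^ x.2) * (1 - C * q ^ (n + x.1))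
      / ((1 - q ^ (n + 1)) * (1 - C * q ^ n)))
    let Y : ℕ × ℕ → ℂ := fun x => F (n + 1) x.1 x.2 * ((1 - q ^ x.1) * q ^ x.2
      * (1 - C * (q ^ x.1 / q)) / ((1 - q ^ (n + 1)) * (1 - C * q ^ n)))
    have hn : 1 - q ^ (n + 1) ≠ 0 :=
      sub_ne_zero.2 (by rw [pow_succ']; exact (pow_succ_ne_one hq n).symm)
    have hCn : 1 - C * q ^ n ≠ 0 := sub_ne_zero.2 (hC n n.lt_succ_self).symm
    have hX : ∀ j m, j + m = n →
        X (j, m + 1) = F n j m * ((1 - D * q ^ m) * (1 - C * q ^ (n + j))) := by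
      rintro j m rfl
      have h1 := qShift_self_ne_zero hq j
      have h2 := qShift_self_ne_zero hq m
      have h3 : 1 - q * q ^ m ≠ 0 := sub_ne_zero.2 (pow_succ_ne_one hq m).symm
      simp only [X, F, qShift_succ]
      rw [show 1 - q ^ (m + 1) = 1 - q * q ^ m by ring]
      rw [show 1 - q ^ (j + m + 1) = 1 - q * q ^ (j + m) by ring] at hn ⊢
      rw [show C * q ^ j * q ^ m = C * q ^ (j + m) by ring]
      generalize 1 - C * q ^ (j + m) = z1 at *
      generalize 1 - q * q ^ (j + m) = z2 at *
      generalize 1 - q * q ^ m = z3 at *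
      field_simp
    have hY : ∀ j m, j + m = n →
        Y (j + 1, m) = F n j m * (D * q ^ m * ((1 - A * q ^ j) * (1 - B * q ^ j))) := by
      rintro j m rfl
      have h1 := qShift_self_ne_zero hq j
      have h2 := qShift_self_ne_zero hq m
      have h3 : 1 - q * q ^ j ≠ 0 := sub_ne_zero.2 (pow_succ_ne_one hq j).symm
      have hs : (1 - C * q ^ j) * qShift (C * q ^ (j + 1)) q m
          = qShift (C * q ^ j) q m * (1 - C * q ^ (j + m)) := by
        rw [pow_succ, ← mul_assoc, ← qShift_succ', qShift_succ, pow_add]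
        ring
      simp only [Y, F]
      simp only [qShift_succ q, qShift_succ A, qShift_succ B]
      rw [show 1 - q ^ (j + 1) = 1 - q * q ^ j by ring,
        show q ^ (j + 1) / q = q ^ j by rw [pow_succ]; field_simp]
      rw [show 1 - q ^ (j + m + 1) = 1 - q * q ^ (j + m) by ring] at hn ⊢
      generalize qShift (C * q ^ (j + 1)) q m = w at *
      generalize qShift (C * q ^ j) q m = w' at *
      generalize 1 - C * q ^ j = z4 at *
      generalize 1 - C * q ^ (j + m) = z1 at *
      generalize 1 - q * q ^ (j + m) = z2 at *
      generalize 1 - q * q ^ j = z3 at *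
      field_simp
      linear_combination qShift q q (j + m) * qShift D q m * D ^ (j + 1) * qShift A q j
        * qShift B q j * (1 - A * q ^ j) * (1 - B * q ^ j) * hs
    have hXY : ∀ x ∈ Finset.HasAntidiagonal.antidiagonal (n + 1), F (n + 1) x.1 x.2 = X x + Y x := by
      rintro ⟨j, m⟩ hjm
      have hjm : j + m = n + 1 := by simpa using hjm
      have e : q ^ (n + j) = q ^ n * q ^ j := pow_add _ _ _
      have e1 : q ^ j * q ^ m = q * q ^ n := by rw [← pow_add, hjm, pow_succ']
      simp only [X, Y]
      rw [← mul_add, ← add_div, eq_comm]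
      refine mul_right_eq_self₀.2 (Or.inl ?_)
      rw [div_eq_one_iff_eq (mul_ne_zero hn hCn), e, pow_succ]
      field_simp
      linear_combination (q * C * q ^ n - C - q + C * q ^ j) * e1
    have hsum : ∑ x ∈ Finset.HasAntidiagonal.antidiagonal (n + 1), F (n + 1) x.1 x.2
        = ∑ x ∈ Finset.HasAntidiagonal.antidiagonal n,
          F n x.1 x.2 * ((1 - D * A * q ^ n) * (1 - D * B * q ^ n)) := by
      rw [Finset.sum_congr rfl hXY, Finset.sum_add_distrib, Finset.Nat.sum_antidiagonal_succ',
        Finset.Nat.sum_antidiagonal_succ]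
      have x0 : X (n + 1, 0) = 0 := by simp [X]
      have y0 : Y (0, n + 1) = 0 := by simp [Y]
      rw [x0, y0, zero_add, zero_add, ← Finset.sum_add_distrib]
      refine Finset.sum_congr rfl fun x hx => ?_
      have hx := Finset.HasAntidiagonal.mem_antidiagonal.1 hx
      rw [hX _ _ hx, hY _ _ hx, ← hx, hCdef]
      ring
    rw [qShift_succ, qShift_succ]
    change _ = ∑ x ∈ Finset.HasAntidiagonal.antidiagonal (n + 1), F (n + 1) x.1 x.2
    rw [hsum, ← Finset.sum_mul]
    have := ih fun j hj => hC j (hj.trans n.lt_succ_self)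
    change _ = ∑ x ∈ Finset.HasAntidiagonal.antidiagonal n, F n x.1 x.2 at this
    rw [← this]
    ring

/-- Reversing the last j factors of a shifted factorial produces the negative powers of q. After
(x;q)_m (y;q)_m is split off, what remains on either side is one product symmetric in x and y. -/
theorem qShift_reflect {q : ℂ} (hq : q ≠ 0) {x y : ℂ} (hx : x ≠ 0) (hy : y ≠ 0) (j m : ℕ) :
    qShift x q (m + j) * qShift y q m * (y ^ j * qShift (q ^ (1 - ((m + j : ℕ) : ℤ)) / y) q j)
      = qShift y q (m + j) * qShift x q m
        * (x ^ j * qShift (q ^ (1 - ((m + j : ℕ) : ℤ)) / x) q j) := by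
  have key : ∀ x y : ℂ, y ≠ 0 →
      qShift (x * q ^ m) q j * (y ^ j * qShift (q ^ (1 - ((m + j : ℕ) : ℤ)) / y) q j)
        = ∏ i ∈ Finset.range j, ((1 - x * q ^ (m + (j - 1 - i)))
          * (1 - y * q ^ (m + (j - 1 - i))) * -(q ^ (m + (j - 1 - i)))⁻¹) := by
    intro x y hy
    have hc : y ^ j = ∏ _i ∈ Finset.range j, y := by simp
    rw [qShift, ← Finset.prod_range_reflect, qShift, hc, ← Finset.prod_mul_distrib,
      ← Finset.prod_mul_distrib]
    refine Finset.prod_congr rfl fun i hi => ?_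
    have hi := Finset.mem_range.1 hi
    have e : q ^ (1 - ((m + j : ℕ) : ℤ)) * q ^ i = (q ^ (m + (j - 1 - i)))⁻¹ := by
      rw [← zpow_natCast q i, ← zpow_natCast q (m + _), ← zpow_add₀ hq, ← zpow_neg]
      congr 1
      omega
    rw [div_mul_eq_mul_div, e, pow_add]
    field_simp
    ring
  rw [qShift_add, qShift_add]
  have h := (key x y hy).trans ((Finset.prod_congr rfl fun i _ => by ring).trans (key y x hx).symm)
  linear_combination qShift x q m * qShift y q m * h

/-- The `q`-Pfaff–Saalschütz sum. -/
theorem saalschutz {q : ℂ} (hq0 : q ≠ 0) (hq : ‖q‖ < 1) {A B C D : ℂ} (hD : D ≠ 0)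
    (hCD : C = D * A * B) (n : ℕ) (hC : ∀ j < n, C * q ^ j ≠ 1)
    (hDn : ∀ j < n, q ^ (1 - (n : ℤ)) / D * q ^ j ≠ 1) :
    qShift (D * A) q n * qShift (D * B) q n = ∑ j ∈ Finset.range (n + 1),
      qShift C q n * qShift D q n * (qShift (q ^ (-(n : ℤ))) q j * q ^ j
        / (qShift q q j * qShift C q j * qShift (q ^ (1 - (n : ℤ)) / D) q j))
        * (qShift A q j * qShift B q j) := by
  subst hCD
  rw [sum_antidiagonal_saalschutz hq0 hq A B D n hC,
    Finset.Nat.sum_antidiagonal_eq_sum_range_succ_mk]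
  refine Finset.sum_congr rfl fun j hj => ?_
  obtain ⟨m, rfl⟩ := Nat.exists_eq_add_of_le' (Nat.lt_succ_iff.1 (Finset.mem_range.1 hj))
  rw [Nat.add_sub_cancel]
  congr 1
  have h1 := qShift_self_ne_zero hq j
  have h2 := qShift_self_ne_zero hq m
  have h3 : qShift (D * A * B) q j ≠ 0 := qShift_ne_zero fun i hi => hC i (by omega)
  have h4 : qShift (q ^ (1 - ((m + j : ℕ) : ℤ)) / D) q j ≠ 0 :=
    qShift_ne_zero fun i hi => hDn i (by omega)
  -- With x = q and y = D this converts the quotient of (D;q)_m by (q;q)_m into shifted factorials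
  -- of length j, with bases q^(-n) and q^(1-n)/D.
  have h5 := qShift_reflect hq0 hq0 hD j m
  have e : q ^ (1 - ((m + j : ℕ) : ℤ)) / q = q ^ (-((m + j : ℕ) : ℤ)) := by
    rw [sub_eq_add_neg, zpow_add₀ hq0, zpow_one]
    field_simp
  rw [e] at h5
  rw [show qShift (D * A * B) q (m + j)
    = qShift (D * A * B) q j * qShift (D * A * B * q ^ j) q m by rw [add_comm, qShift_add]]
  field_simp
  linear_combination qShift (D * A * B * q ^ j) q m * h5

/-! ### Two further parameters and the terminating expansion -/

section

variable {q a u₁ u₂ u₃ u₄ : ℂ}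

/-- Multiplying h by (q^k - u₁)(1 - a q^k u₁)/q^k yields a solution of the recurrence with u₁/q in
place of u₁, so the contiguous relation can be applied again, at the cost of one moment. A general
solution h is used because u₁/q^i need not be admissible. -/
theorem iterated_contiguous_relation (hq : q ≠ 0) {h : ℤ → ℂ}
    (hrec : ∀ k : ℤ, h (k + 1) * ((1 - a * q * u₁ * q ^ k) * (1 - a * q * u₂ * q ^ k)
        * (1 - a * q * u₃ * q ^ k) * (1 - a * q * u₄ * q ^ k))
      = q * a ^ 2 * (h k * ((u₁ - q ^ k) * (u₂ - q ^ k) * (u₃ - q ^ k) * (u₄ - q ^ k))))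
    {n : ℕ} (hs : SummableMoments q h n) (j : ℕ) (hj : j ≤ n) :
    (SummableMoments q (fun k => h k * ∏ i ∈ Finset.range j,
        ((q ^ k - u₁ / q ^ i) * (1 - a * q ^ k * (u₁ / q ^ i)) / q ^ k)) (n - j)) ∧
    (∏ i ∈ Finset.range j, (1 - a ^ 2 * (u₁ / q ^ i * u₂ * u₃ * u₄))) *
        (∑' k : ℤ, (1 - a * (q ^ k) ^ 2) * (h k * ∏ i ∈ Finset.range j,
          ((q ^ k - u₁ / q ^ i) * (1 - a * q ^ k * (u₁ / q ^ i)) / q ^ k)))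
      = (∏ i ∈ Finset.range j, ((1 - a * (u₁ / q ^ i) * u₂) * (1 - a * (u₁ / q ^ i) * u₃)
          * (1 - a * (u₁ / q ^ i) * u₄))) * ∑' k : ℤ, (1 - a * (q ^ k) ^ 2) * h k := by
  induction j generalizing h u₁ n with
  | zero => simpa using hs
  | succ j ih =>
    obtain ⟨n, rfl⟩ : ∃ n', n = n' + 1 := ⟨n - 1, by omega⟩
    have hs1 : SummableMoments q h 1 := fun s h1 h2 =>
      hs s (by push_cast at h1 ⊢; omega) (by push_cast at h2 ⊢; omega)
    have hc := contiguous_relation hq hrec hs1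
    have hrec' : ∀ k : ℤ, h (k + 1) * ((q ^ (k + 1) - u₁) * (1 - a * q ^ (k + 1) * u₁)
          / q ^ (k + 1))
        * ((1 - a * q * (u₁ / q) * q ^ k) * (1 - a * q * u₂ * q ^ k)
          * (1 - a * q * u₃ * q ^ k) * (1 - a * q * u₄ * q ^ k))
        = q * a ^ 2 * (h k * ((q ^ k - u₁) * (1 - a * q ^ k * u₁) / q ^ k)
          * ((u₁ / q - q ^ k) * (u₂ - q ^ k) * (u₃ - q ^ k) * (u₄ - q ^ k))) := by
      intro k
      have hr := hrec k
      have hK : q ^ k ≠ 0 := zpow_ne_zero _ hq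
      rw [zpow_add_one₀ hq]
      generalize q ^ k = K at *
      field_simp
      linear_combination (K * q - u₁) * (1 - a * K * u₁) * hr
    obtain ⟨i1, i2⟩ := ih hrec' (hs.step hq a u₁) (by omega)
    have hu : ∀ i : ℕ, u₁ / q ^ (i + 1) = u₁ / q / q ^ i := fun i => by
      rw [pow_succ', div_div]
    have e : ∀ k : ℤ, h k * ∏ i ∈ Finset.range (j + 1),
        ((q ^ k - u₁ / q ^ i) * (1 - a * q ^ k * (u₁ / q ^ i)) / q ^ k)
        = h k * ((q ^ k - u₁) * (1 - a * q ^ k * u₁) / q ^ k) * ∏ i ∈ Finset.range j,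
        ((q ^ k - u₁ / q / q ^ i) * (1 - a * q ^ k * (u₁ / q / q ^ i)) / q ^ k) := by
      intro k
      rw [Finset.prod_range_succ', pow_zero, div_one]
      simp only [hu]
      ring
    simp only [e]
    refine ⟨by simpa using i1, ?_⟩
    simp only [Finset.prod_range_succ', pow_zero, div_one, hu]
    rw [mul_right_comm, i2]
    linear_combination (∏ i ∈ Finset.range j, ((1 - a * (u₁ / q / q ^ i) * u₂)
      * (1 - a * (u₁ / q / q ^ i) * u₃) * (1 - a * (u₁ / q / q ^ i) * u₄))) * hc

/-- The integrals of the basis functions of the `q`-Saalschütz expansion against the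
very-well-poised weight. -/
theorem tsum_mul_qShift (hq : q ≠ 0) (ha : a ≠ 0) (n₁ : u₁ ≠ 0) (n₂ : u₂ ≠ 0) (n₃ : u₃ ≠ 0)
    (n₄ : u₄ ≠ 0) {h : ℤ → ℂ}
    (hrec : ∀ k : ℤ, h (k + 1) * ((1 - a * q * u₁ * q ^ k) * (1 - a * q * u₂ * q ^ k)
        * (1 - a * q * u₃ * q ^ k) * (1 - a * q * u₄ * q ^ k))
      = q * a ^ 2 * (h k * ((u₁ - q ^ k) * (u₂ - q ^ k) * (u₃ - q ^ k) * (u₄ - q ^ k))))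
    {n : ℕ} (hs : SummableMoments q h n) (j : ℕ) (hj : j ≤ n) :
    (Summable fun k : ℤ => (1 - a * (q ^ k) ^ 2)
      * (h k * (qShift (q ^ k / u₁) q j * qShift (1 / (q ^ k * a * u₁)) q j))) ∧
    qShift (1 / (a ^ 2 * (u₁ * u₂ * u₃ * u₄))) q j * (∑' k : ℤ, (1 - a * (q ^ k) ^ 2)
        * (h k * (qShift (q ^ k / u₁) q j * qShift (1 / (q ^ k * a * u₁)) q j)))
      = qShift (1 / (a * u₁ * u₂)) q j * qShift (1 / (a * u₁ * u₃)) q j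
        * qShift (1 / (a * u₁ * u₄)) q j * ∑' k : ℤ, (1 - a * (q ^ k) ^ 2) * h k := by
  obtain ⟨i1, i2⟩ := iterated_contiguous_relation hq hrec hs j hj
  -- W, and V below, collect the monomials left when each 1 - c q^i is rewritten through 1 - 1/(c
  -- q^i), the form in which the iterated relation is stated.
  set W : ℂ := ∏ i ∈ Finset.range j, ((q ^ i) ^ 2 / (a * u₁ ^ 2))
  have e : ∀ k : ℤ, (1 - a * (q ^ k) ^ 2)
      * (h k * (qShift (q ^ k / u₁) q j * qShift (1 / (q ^ k * a * u₁)) q j))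
      = W * ((1 - a * (q ^ k) ^ 2) * (h k * ∏ i ∈ Finset.range j,
          ((q ^ k - u₁ / q ^ i) * (1 - a * q ^ k * (u₁ / q ^ i)) / q ^ k))) := by
    intro k
    have : qShift (q ^ k / u₁) q j * qShift (1 / (q ^ k * a * u₁)) q j
        = W * ∏ i ∈ Finset.range j,
          ((q ^ k - u₁ / q ^ i) * (1 - a * q ^ k * (u₁ / q ^ i)) / q ^ k) := by
      simp only [W, qShift, ← Finset.prod_mul_distrib]
      refine Finset.prod_congr rfl fun i _ => ?_
      have hK : q ^ k ≠ 0 := zpow_ne_zero _ hq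
      have hi : q ^ i ≠ 0 := pow_ne_zero _ hq
      field_simp
      ring
    rw [this]
    ring
  simp only [e]
  refine ⟨(i1.summable a).mul_left W, ?_⟩
  rw [tsum_mul_left]
  set V : ℂ := ∏ i ∈ Finset.range j, -(q ^ i / (a ^ 2 * (u₁ * u₂ * u₃ * u₄))) with hV
  have eV : qShift (1 / (a ^ 2 * (u₁ * u₂ * u₃ * u₄))) q j
      = V * ∏ i ∈ Finset.range j, (1 - a ^ 2 * (u₁ / q ^ i * u₂ * u₃ * u₄)) := by
    simp only [V, qShift, ← Finset.prod_mul_distrib]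
    refine Finset.prod_congr rfl fun i _ => ?_
    have hi : q ^ i ≠ 0 := pow_ne_zero _ hq
    field_simp
    ring
  have eR : qShift (1 / (a * u₁ * u₂)) q j * qShift (1 / (a * u₁ * u₃)) q j
        * qShift (1 / (a * u₁ * u₄)) q j
      = V * W * ∏ i ∈ Finset.range j, ((1 - a * (u₁ / q ^ i) * u₂)
        * (1 - a * (u₁ / q ^ i) * u₃) * (1 - a * (u₁ / q ^ i) * u₄)) := by
    simp only [V, W, qShift, ← Finset.prod_mul_distrib]
    refine Finset.prod_congr rfl fun i _ => ?_
    have hi : q ^ i ≠ 0 := pow_ne_zero _ hq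
    field_simp
    ring
  rw [eV, eR]
  linear_combination V * W * i2

/-- Two more parameters whose product is `q ^ (-n) / (a q)` contribute a Laurent polynomial. -/
theorem wpFactor_mul_wpFactor (hq : q ≠ 0) (ha : a ≠ 0) {w w' : ℂ} {n : ℕ} (hw : w ≠ 0)
    (hw' : w' = 1 / (a * w * q ^ (n + 1))) (h : WPAdmissible q a w) (h' : WPAdmissible q a w')
    (k : ℤ) :
    (a * q) ^ k * wpFactor q a w k * wpFactor q a w' k
        * (qShift (q * w) q n * qShift (a * q * w) q n)
      = qShift (q * w / q ^ k) q n * qShift (a * q * w * q ^ k) q n := by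
  refine eq_of_recurrence
    (F := fun k => (a * q) ^ k * wpFactor q a w k * wpFactor q a w' k
        * (qShift (q * w) q n * qShift (a * q * w) q n))
    (G := fun k => qShift (q * w / q ^ k) q n * qShift (a * q * w * q ^ k) q n)
    (α := fun k => (1 - a * q * w * q ^ k) * (1 - a * q * w' * q ^ k))
    (β := fun k => a * q * ((w - q ^ k) * (w' - q ^ k)))
    (fun i => ?_) (fun i => ?_) (fun k => ?_) (fun k => ?_) ?_ k
  · rw [zpow_natCast]
    exact mul_ne_zero (sub_ne_zero.2 (h.1 i).symm) (sub_ne_zero.2 (h'.1 i).symm)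
  · have : ∀ u, WPAdmissible q a u → u - q ^ (-((i : ℤ) + 1)) ≠ 0 := by
      intro u hu e
      rw [sub_eq_zero] at e
      apply hu.2 i
      rw [e, zpow_neg, zpow_add_one₀ hq, zpow_natCast]
      field_simp
    exact mul_ne_zero (mul_ne_zero ha hq) (mul_ne_zero (this w h) (this w' h'))
  · have e1 := wpFactor_add_one hq h k
    have e2 := wpFactor_add_one hq h' k
    simp only [zpow_add_one₀ (mul_ne_zero ha hq)]
    linear_combination (a * q) ^ k * (a * q) * (qShift (q * w) q n * qShift (a * q * w) q n)
      * (wpFactor q a w' (k + 1) * (1 - a * q * w' * q ^ k) * e1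
        + wpFactor q a w k * (w - q ^ k) * e2)
  · have hK : q ^ k ≠ 0 := zpow_ne_zero _ hq
    have hQ : q ^ n ≠ 0 := pow_ne_zero _ hq
    simp only [zpow_add_one₀ hq]
    generalize q ^ k = K at *
    have s1 : qShift (w / K) q n * (1 - w / K * q ^ n) = (1 - w / K) * qShift (q * w / K) q n := by
      rw [← qShift_succ, qShift_succ', div_mul_eq_mul_div, mul_comm w q]
    have s2 : qShift (a * q * w * K) q n * (1 - a * q * w * K * q ^ n)
        = (1 - a * q * w * K) * qShift (a * q * w * (K * q)) q n := by
      rw [← qShift_succ, qShift_succ', mul_assoc _ K q]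
    rw [show q * w / (K * q) = w / K by field_simp]
    -- Since a w w' q^(n+1) = 1, the factors coming from w' are those of w shifted by n, up to a
    -- monomial common to t1 and t2.
    have t1 : 1 - a * q * w' * K = -(K / (w * q ^ n)) * (1 - w / K * q ^ n) := by
      rw [hw', pow_succ]; field_simp; ring
    have t2 : a * q * ((w - K) * (w' - K)) = -(K / (w * q ^ n)) * (1 - w / K)
        * (1 - a * q * w * K * q ^ n) := by
      rw [hw', pow_succ]; field_simp; ring
    rw [t1, t2]
    linear_combination -(K / (w * q ^ n)) * ((1 - a * q * w * K)
      * qShift (a * q * w * (K * q)) q n * s1 - (1 - w / K) * qShift (q * w / K) q n * s2)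
  · simp [wpFactor_zero]

end

section

variable {q a u₁ u₂ u₃ u₄ : ℂ}

/-- Expansion of a bilateral very-well-poised series with six parameters, two of which have the
product `q ^ (-n) / (a q)`, in terms of a terminating series. -/
theorem tsum_wpProd_mul_eq (hq0 : q ≠ 0) (hq : ‖q‖ < 1) (ha : a ≠ 0)
    (h₁ : WPAdmissible q a u₁) (h₂ : WPAdmissible q a u₂) (h₃ : WPAdmissible q a u₃)
    (h₄ : WPAdmissible q a u₄) (n₁ : u₁ ≠ 0) (n₂ : u₂ ≠ 0) (n₃ : u₃ ≠ 0) (n₄ : u₄ ≠ 0)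
    {n : ℕ} (hr : ‖q * a ^ 2 * (u₁ * u₂ * u₃ * u₄)‖ < ‖q‖ ^ n) {w w' : ℂ} (hw : w ≠ 0)
    (hw' : w' = 1 / (a * w * q ^ (n + 1))) (h : WPAdmissible q a w) (h' : WPAdmissible q a w')
    (hC : ∀ j < n, q * w / u₁ * q ^ j ≠ 1)
    (hD : ∀ j < n, q ^ (1 - (n : ℤ)) / (a * q * u₁ * w) * q ^ j ≠ 1)
    (hQ : qShift (q * w) q n * qShift (a * q * w) q n ≠ 0) :
    HasSum (fun k : ℤ => (1 - a * (q ^ k) ^ 2) * (wpProd q a u₁ u₂ u₃ u₄ k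
      * ((a * q) ^ k * wpFactor q a w k * wpFactor q a w' k)))
      (wpSum q a u₁ u₂ u₃ u₄ * (qShift (a * q * u₁ * w) q n * qShift (q * w / u₁) q n
        * ∑ j ∈ Finset.range (n + 1), qShift (q ^ (-(n : ℤ))) q j
          * qShift (1 / (a * u₁ * u₂)) q j * qShift (1 / (a * u₁ * u₃)) q j
          * qShift (1 / (a * u₁ * u₄)) q j
          / (qShift q q j * qShift (q ^ (1 - (n : ℤ)) / (a * q * u₁ * w)) q j
            * qShift (q * w / u₁) q j * qShift (1 / (a ^ 2 * (u₁ * u₂ * u₃ * u₄))) q j) * q ^ j)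
        / (qShift (q * w) q n * qShift (a * q * w) q n)) := by
  have hqn : 0 < ‖q‖ := norm_pos_iff.2 hq0
  have hs := summableMoments_wpProd hq0 hq ha h₁ h₂ h₃ h₄ (norm_pos_iff.2 n₁)
    (norm_pos_iff.2 n₂) (norm_pos_iff.2 n₃) (norm_pos_iff.2 n₄) le_rfl le_rfl le_rfl le_rfl
    (n := n) (by simpa using hr)
  have hrec := wpProd_recurrence hq0 ha h₁ h₂ h₃ h₄
  -- A vanishing denominator would mean a²u₁u₂u₃u₄ = q^i with i < n, contradicting the decay
  -- assumption.
  have hU : ∀ i < n, 1 / (a ^ 2 * (u₁ * u₂ * u₃ * u₄)) * q ^ i ≠ 1 := by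
    intro i hi hu
    rw [one_div_mul_eq_div, div_eq_one_iff_eq (by simp [*])] at hu
    rw [mul_assoc, ← hu, ← pow_succ', norm_pow] at hr
    exact absurd (pow_le_pow_of_le_one hqn.le hq.le (Nat.succ_le_of_lt hi)) (not_le.2 hr)
  obtain ⟨κ, hκ⟩ : ∃ κ : ℕ → ℂ, ∀ j, κ j =
      qShift (q * w / u₁) q n * qShift (a * q * u₁ * w) q n
          * (qShift (q ^ (-(n : ℤ))) q j * q ^ j / (qShift q q j * qShift (q * w / u₁) q j
            * qShift (q ^ (1 - (n : ℤ)) / (a * q * u₁ * w)) q j))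
          / (qShift (q * w) q n * qShift (a * q * w) q n) :=
    ⟨_, fun _ => rfl⟩
  have hterm : ∀ k : ℤ, (1 - a * (q ^ k) ^ 2) * (wpProd q a u₁ u₂ u₃ u₄ k
      * ((a * q) ^ k * wpFactor q a w k * wpFactor q a w' k))
      = ∑ j ∈ Finset.range (n + 1),
        κ j * ((1 - a * (q ^ k) ^ 2) * (wpProd q a u₁ u₂ u₃ u₄ k
          * (qShift (q ^ k / u₁) q j * qShift (1 / (q ^ k * a * u₁)) q j))) := by
    intro k
    have hK : q ^ k ≠ 0 := zpow_ne_zero _ hq0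
    have e1 := wpFactor_mul_wpFactor hq0 ha hw hw' h h' k
    -- A and B are chosen so that DA = aqw q^k and DB = qw/q^k, the bases of the Laurent polynomial,
    -- while C and D do not depend on k.
    have e2 := saalschutz hq0 hq (A := q ^ k / u₁) (B := 1 / (q ^ k * a * u₁))
      (C := q * w / u₁) (D := a * q * u₁ * w) (by simp [*]) (by field_simp) n hC hD
    rw [show a * q * u₁ * w * (q ^ k / u₁) = a * q * w * q ^ k by field_simp,
      show a * q * u₁ * w * (1 / (q ^ k * a * u₁)) = q * w / q ^ k by field_simp,
      mul_comm (qShift (a * q * w * q ^ k) q n), ← e1] at e2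
    rw [eq_div_of_mul_eq hQ e2, Finset.sum_div, Finset.mul_sum, Finset.mul_sum]
    exact Finset.sum_congr rfl fun j _ => by rw [hκ]; ring
  simp only [hterm]
  have hj := fun j (hj : j ∈ Finset.range (n + 1)) =>
    tsum_mul_qShift hq0 ha n₁ n₂ n₃ n₄ hrec hs j (Nat.lt_succ_iff.1 (Finset.mem_range.1 hj))
  convert hasSum_sum fun j hjn => (hj j hjn).1.hasSum.mul_left (κ j) using 1
  · rfl
  rw [Finset.mul_sum, Finset.mul_sum, Finset.sum_div]
  refine Finset.sum_congr rfl fun j hjn => ?_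
  have hβ : qShift (1 / (a ^ 2 * (u₁ * u₂ * u₃ * u₄))) q j ≠ 0 :=
    qShift_ne_zero fun i hi => hU i (by have := Finset.mem_range.1 hjn; omega)
  rw [eq_div_of_mul_eq hβ ((mul_comm _ _).trans (hj j hjn).2), wpSum, hκ]
  ring

end

/-! ### Matching the two given series with the bilateral one -/

theorem prod_neg_pow_ne_zero {q : ℂ} (hq : q ≠ 0) (k : ℕ) :
    ∏ i ∈ Finset.range k, -(q ^ i) ≠ 0 :=
  Finset.prod_ne_zero_iff.2 fun i _ => neg_ne_zero.2 (pow_ne_zero i hq)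

/-- Five of the six quotients in each term carry a shift q^(-k), and each leaves a denominator ∏
-(q^i); the quadratic power of q cancels precisely these five. -/
theorem pow_pentagonal (q : ℂ) (k : ℕ) :
    q ^ (k * (5 * k + 3) / 2) = (∏ i ∈ Finset.range k, -(q ^ i)) ^ 5 * (-q ^ 4) ^ k := by
  induction k with
  | zero => simp
  | succ k ih =>
    have : (k + 1) * (5 * (k + 1) + 3) / 2 = k * (5 * k + 3) / 2 + (5 * k + 4) := by
      rw [← Nat.add_mul_div_right _ _ two_pos]
      congr 1
      ring
    rw [this, pow_add, ih, Finset.prod_range_succ, mul_pow, pow_succ (-q ^ 4)]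
    ring

theorem qShift_zpow_neg_mul {q : ℂ} (hq : q ≠ 0) (u : ℂ) (k : ℕ) :
    qShift (q ^ (-(k : ℤ)) * (q * u)) q k * ∏ i ∈ Finset.range k, -(q ^ i)
      = ∏ i ∈ Finset.range k, (u - q ^ i) := by
  rw [qShift, ← Finset.prod_range_reflect, ← Finset.prod_mul_distrib]
  refine Finset.prod_congr rfl fun i hi => ?_
  have hi := Finset.mem_range.1 hi
  have e : q ^ (-(k : ℤ)) * q * q ^ (k - 1 - i) = (q ^ i)⁻¹ := by
    rw [← zpow_natCast q i, ← zpow_natCast q (k - 1 - i), ← zpow_add_one₀ hq, ← zpow_add₀ hq,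
      ← zpow_neg]
    congr 1
    omega
  have hqi : q ^ i ≠ 0 := pow_ne_zero _ hq
  calc _ = (1 - u * (q ^ (-(k : ℤ)) * q * q ^ (k - 1 - i))) * -(q ^ i) := by ring
    _ = _ := by rw [e]; field_simp; ring

section

variable {q a u : ℂ}

theorem wpFactor_natCast_eq (q a u : ℂ) (k : ℕ) :
    wpFactor q a u k = (∏ i ∈ Finset.range k, (u - q ^ i)) / qShift (a * u * q) q k := by
  rw [wpFactor_natCast, Finset.prod_div_distrib, qShift]
  congr 1
  exact Finset.prod_congr rfl fun i _ => by ring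

/-- Index -(k+1) is where the k-th term of the second series sits. Peeling off the factor i = 0 of
the numerator leaves k factors; their common q^k and the prefactor q^(k+1) give q^(2k+1). -/
theorem wpFactor_neg_succ_eq (hq : q ≠ 0) (a u : ℂ) (k : ℕ) :
    wpFactor q a u (-((k : ℤ) + 1)) = -(1 - a * u) * q ^ (2 * k + 1)
      * (∏ i ∈ Finset.range k, (a * u / q - q ^ i)) / qShift (q * u) q (k + 1) := by
  have := wpFactor_neg q a u (k + 1)
  push_cast at this
  rw [this, Finset.prod_mul_distrib, Finset.prod_div_distrib,
    Finset.prod_range_succ' fun i => a * u - q ^ i]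
  have e : ∏ i ∈ Finset.range k, (a * u - q ^ (i + 1))
      = q ^ k * ∏ i ∈ Finset.range k, (a * u / q - q ^ i) := by
    have hc : q ^ k = ∏ _i ∈ Finset.range k, q := by simp
    rw [hc, ← Finset.prod_mul_distrib]
    exact Finset.prod_congr rfl fun i _ => by field_simp; ring
  rw [e, Finset.prod_const, Finset.card_range, qShift]
  ring

theorem qShift_zpow_div_qShift (hq : q ≠ 0) (a u : ℂ) (k : ℕ) :
    qShift (q ^ (-(k : ℤ)) * (q * u)) q k / qShift (a * u) q (k + 1)
      = wpFactor q a u k / ((1 - a * u) * ∏ i ∈ Finset.range k, -(q ^ i)) := by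
  have hR := prod_neg_pow_ne_zero hq k
  rw [wpFactor_natCast_eq, ← qShift_zpow_neg_mul hq, qShift_succ']
  field_simp

theorem qShift_zpow_div_qShift_neg (hq : q ≠ 0) (h0 : 1 - a * u ≠ 0) (k : ℕ) :
    qShift (q ^ (-(k : ℤ)) * (a * u)) q k / qShift (q * u) q (k + 1)
      = -wpFactor q a u (-((k : ℤ) + 1)) / ((1 - a * u) * q ^ (2 * k + 1)
        * ∏ i ∈ Finset.range k, -(q ^ i)) := by
  have hR := prod_neg_pow_ne_zero hq k
  have hk : q ^ (2 * k + 1) ≠ 0 := pow_ne_zero _ hq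
  rw [wpFactor_neg_succ_eq hq, ← qShift_zpow_neg_mul hq, mul_div_cancel₀ _ hq]
  generalize q ^ (2 * k + 1) = z at *
  field_simp

/-- Serves u₁, the one parameter whose numerator has no shift q^(-k), hence the power u^k in place
of ∏ -(q^i). -/
theorem qShift_inv_div_qShift (hu : u ≠ 0) (a : ℂ) (k : ℕ) :
    qShift u⁻¹ q k / qShift (a * u) q (k + 1) = wpFactor q a u k / ((1 - a * u) * u ^ k) := by
  have e : ∏ i ∈ Finset.range k, (u - q ^ i) = u ^ k * qShift u⁻¹ q k := by
    have hc : u ^ k = ∏ _i ∈ Finset.range k, u := by simp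
    rw [hc, qShift, ← Finset.prod_mul_distrib]
    exact Finset.prod_congr rfl fun i _ => by field_simp
  have huk : u ^ k ≠ 0 := pow_ne_zero _ hu
  rw [wpFactor_natCast_eq, e, qShift_succ']
  field_simp

theorem qShift_inv_div_qShift_neg (hq : q ≠ 0) (ha : a ≠ 0) (hu : u ≠ 0) (h0 : 1 - a * u ≠ 0)
    (k : ℕ) :
    qShift (q / (a * u)) q k / qShift (q * u) q (k + 1)
      = -wpFactor q a u (-((k : ℤ) + 1)) / ((1 - a * u) * q ^ (2 * k + 1))
        * (q / (a * u)) ^ k := by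
  have e : qShift (q / (a * u)) q k
      = (q / (a * u)) ^ k * ∏ i ∈ Finset.range k, (a * u / q - q ^ i) := by
    have hc : (q / (a * u)) ^ k = ∏ _i ∈ Finset.range k, (q / (a * u)) := by
      rw [Finset.prod_const, Finset.card_range]
    rw [hc, qShift, ← Finset.prod_mul_distrib]
    exact Finset.prod_congr rfl fun i _ => by field_simp
  have hk : q ^ (2 * k + 1) ≠ 0 := pow_ne_zero _ hq
  rw [wpFactor_neg_succ_eq hq, e]
  generalize q ^ (2 * k + 1) = z at *
  generalize (q / (a * u)) ^ k = z' at *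
  field_simp

end

theorem prod_six_div_eq {A y₁ y₂ z₁ z₂ z R g1 g2 g3 g4 g5 g6 s1 s2 s3 s4 s5 s6 N1 N2 N3 N4 N5 N6
    D1 D2 D3 D4 D5 D6 : ℂ} (hR : R ≠ 0) (hz : z ≠ 0)
    (e1 : N1 / D1 = g1 / (s1 * z)) (e2 : N2 / D2 = g2 / (s2 * R)) (e3 : N3 / D3 = g3 / (s3 * R))
    (e4 : N4 / D4 = g4 / (s4 * R)) (e5 : N5 / D5 = g5 / (s5 * R)) (e6 : N6 / D6 = g6 / (s6 * R))
    (h : y₁ * y₂ = z₁ * z₂ * z) :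
    A * (N1 * (N2 * (N3 * (N4 * (N5 * N6)))) / (D1 * (D2 * (D3 * (D4 * (D5 * D6)))))) * (R ^ 5 * y₁) * y₂
    = A * (z₁ * (g1 * g2 * g3 * g4) * (z₂ * g5 * g6)) / (s1 * s2 * s3 * s4 * s5 * s6) := by
  simp only [mul_div_mul_comm N1, mul_div_mul_comm N2, mul_div_mul_comm N3, mul_div_mul_comm N4,
    mul_div_mul_comm N5, e1, e2, e3, e4, e5, e6]
  simp only [div_mul_eq_mul_div, mul_div_assoc', div_div]
  rw [← mul_div_mul_right _ (s1 * s2 * s3 * s4 * s5 * s6)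
    (mul_ne_zero (pow_ne_zero 5 hR) hz)]
  congr 1
  · linear_combination A * g1 * g2 * g3 * g4 * g5 * g6 * R ^ 5 * h
  · ring

theorem prod_six_neg_div_eq {x Z z z₁ z₂ z₃ z₄ z₅ z₆ R g1 g2 g3 g4 g5 g6 s1 s2 s3 s4 s5 s6 N1 N2 N3
    N4 N5 N6 D1 D2 D3 D4 D5 D6 : ℂ} (hR : R ≠ 0) (hZ : Z ≠ 0)
    (e1 : N1 / D1 = -g1 / (s1 * Z) * z₁) (e2 : N2 / D2 = -g2 / (s2 * Z * R))
    (e3 : N3 / D3 = -g3 / (s3 * Z * R)) (e4 : N4 / D4 = -g4 / (s4 * Z * R))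
    (e5 : N5 / D5 = -g5 / (s5 * Z * R)) (e6 : N6 / D6 = -g6 / (s6 * Z * R))
    (h : x * z * (z₁ * (z₂ * z₃)) = z₆ * (z₄ * z₅) * Z ^ 6) :
    x * (z * (N1 * (N2 * (N3 * (N4 * (N5 * N6)))) / (D1 * (D2 * (D3 * (D4 * (D5 * D6)))))) * (R ^ 5 * z₂) * z₃)
    = z₆ * (z₄ * (g1 * g2 * g3 * g4) * (z₅ * g5 * g6)) / (s1 * s2 * s3 * s4 * s5 * s6) := by
  simp only [mul_div_mul_comm N1, mul_div_mul_comm N2, mul_div_mul_comm N3, mul_div_mul_comm N4,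
    mul_div_mul_comm N5, e1, e2, e3, e4, e5, e6]
  simp only [div_mul_eq_mul_div, mul_div_assoc', div_div]
  rw [← mul_div_mul_right _ (s1 * s2 * s3 * s4 * s5 * s6)
    (mul_ne_zero (pow_ne_zero 5 hR) (pow_ne_zero 6 hZ))]
  congr 1
  · linear_combination g1 * g2 * g3 * g4 * g5 * g6 * R ^ 5 * h
  · ring

section

variable {q a x y b c d e u₁ u₂ u₃ u₄ w w' : ℂ} {n : ℕ}

theorem firstTerm_eq (hq : q ≠ 0) (hx : x ≠ 0) (hy : y ≠ 0) (ha : a = q / x)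
    (a₁ : a * u₁ = y) (a₂ : a * u₂ = b / (x * y)) (a₃ : a * u₃ = c / (x * y))
    (a₄ : a * u₄ = d / (x * y)) (a₅ : a * w = e / (x * y)) (a₆ : a * w' = q ^ (-(n : ℤ)) * y / e)
    (b₁ : q * u₁ = x * y) (b₂ : q * u₂ = b / y) (b₃ : q * u₃ = c / y) (b₄ : q * u₄ = d / y)
    (b₅ : q * w = e / y) (b₆ : q * w' = q ^ (-(n : ℤ)) * x * y / e) (k : ℕ) :
    firstTerm q x y b c d e n k = (1 - a * (q ^ (k : ℤ)) ^ 2) * (wpProd q a u₁ u₂ u₃ u₄ k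
      * ((a * q) ^ (k : ℤ) * wpFactor q a w k * wpFactor q a w' k))
      / ((1 - a * u₁) * (1 - a * u₂) * (1 - a * u₃) * (1 - a * u₄) * (1 - a * w)
        * (1 - a * w')) := by
  have hu : u₁ ≠ 0 := by
    rintro rfl
    rw [mul_zero] at b₁
    exact mul_ne_zero hx hy b₁.symm
  have hinv : q / (x * y) = u₁⁻¹ := by rw [← b₁]; field_simp
  have hR := prod_neg_pow_ne_zero hq k
  have hpow : (-q ^ 4) ^ k * (-y / x ^ 2) ^ k = (q * a ^ 2) ^ k * (a * q) ^ k * u₁ ^ k := by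
    rw [← mul_pow, ← mul_pow, ← mul_pow]
    congr 1
    rw [show q * a ^ 2 * (a * q) * u₁ = q ^ 2 * a ^ 2 * (a * u₁) by ring, a₁, ha]
    field_simp
  have h0 : 1 - q ^ (2 * k + 1) / x = 1 - a * (q ^ (k : ℤ)) ^ 2 := by
    rw [ha, zpow_natCast]; ring
  have hk : q ^ (-(k : ℤ) - n) * x * y / e = q ^ (-(k : ℤ)) * (q * w') := by
    rw [b₆, sub_eq_add_neg, zpow_add₀ hq]; ring
  have e1 := qShift_inv_div_qShift hu a (q := q) k
  have e2 := qShift_zpow_div_qShift hq a u₂ k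
  have e3 := qShift_zpow_div_qShift hq a u₃ k
  have e4 := qShift_zpow_div_qShift hq a u₄ k
  have e5 := qShift_zpow_div_qShift hq a w k
  have e6 := qShift_zpow_div_qShift hq a w' k
  simp only [firstTerm, qShiftList, List.map_cons, List.map_nil, List.prod_cons, List.prod_nil,
    mul_one, mul_div_assoc (q ^ (-(k : ℤ)))]
  rw [pow_pentagonal, h0, hk, ← b₂, ← b₃, ← b₄, ← b₅, ← a₂, ← a₃, ← a₄, ← a₅, ← a₆, hinv]
  rw [show qShift y q (k + 1) = qShift (a * u₁) q (k + 1) by rw [a₁]]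
  exact prod_six_div_eq hR (pow_ne_zero _ hu) e1 e2 e3 e4 e5 e6 hpow

theorem secondTerm_eq (hq : q ≠ 0) (hx : x ≠ 0) (hy : y ≠ 0) (ha : a = q / x)
    (a₁ : a * u₁ = y) (a₂ : a * u₂ = b / (x * y)) (a₃ : a * u₃ = c / (x * y))
    (a₄ : a * u₄ = d / (x * y)) (a₅ : a * w = e / (x * y)) (a₆ : a * w' = q ^ (-(n : ℤ)) * y / e)
    (b₁ : q * u₁ = x * y) (b₂ : q * u₂ = b / y) (b₃ : q * u₃ = c / y) (b₄ : q * u₄ = d / y)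
    (b₅ : q * w = e / y) (b₆ : q * w' = q ^ (-(n : ℤ)) * x * y / e)
    (c₁ : 1 - a * u₁ ≠ 0) (c₂ : 1 - a * u₂ ≠ 0) (c₃ : 1 - a * u₃ ≠ 0) (c₄ : 1 - a * u₄ ≠ 0)
    (c₅ : 1 - a * w ≠ 0) (c₆ : 1 - a * w' ≠ 0) (k : ℕ) :
    -x ^ 2 * secondTerm q x y b c d e n k = (1 - a * (q ^ (-((k : ℤ) + 1))) ^ 2)
      * (wpProd q a u₁ u₂ u₃ u₄ (-((k : ℤ) + 1)) * ((a * q) ^ (-((k : ℤ) + 1))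
        * wpFactor q a w (-((k : ℤ) + 1)) * wpFactor q a w' (-((k : ℤ) + 1))))
      / ((1 - a * u₁) * (1 - a * u₂) * (1 - a * u₃) * (1 - a * u₄) * (1 - a * w)
        * (1 - a * w')) := by
  have hu : u₁ ≠ 0 := by
    rintro rfl
    rw [mul_zero] at b₁
    exact mul_ne_zero hx hy b₁.symm
  have ha0 : a ≠ 0 := ha ▸ div_ne_zero hq hx
  have hR := prod_neg_pow_ne_zero hq k
  have hk : q ^ (-(k : ℤ) - n) * y / e = q ^ (-(k : ℤ)) * (a * w') := by
    rw [a₆, sub_eq_add_neg, zpow_add₀ hq]; ring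
  have hZ : q ^ (2 * k + 1) ≠ 0 := pow_ne_zero _ hq
  -- All monomials of the term. The factor -x² and the six powers q^(2k+1) are what turns 1 -
  -- q^(2k+1)x into 1 - a q^(-2(k+1)).
  have hpow : -x ^ 2 * (1 - q ^ (2 * k + 1) * x) * ((q / (a * u₁)) ^ k
      * ((-q ^ 4) ^ k * (-(x ^ 3 * y)) ^ k))
      = (1 - a * (q ^ (-((k : ℤ) + 1))) ^ 2) * ((q * a ^ 2) ^ (-((k : ℤ) + 1))
        * (a * q) ^ (-((k : ℤ) + 1))) * (q ^ (2 * k + 1)) ^ 6 := by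
    have hqk : q ^ k ≠ 0 := pow_ne_zero _ hq
    have hxk : x ^ k ≠ 0 := pow_ne_zero _ hx
    have l : (q / (a * u₁)) * (-q ^ 4 * -(x ^ 3 * y)) = q ^ 5 * x ^ 3 := by
      rw [a₁]; field_simp
    have r : q * a ^ 2 * (a * q) = q ^ 5 / x ^ 3 := by rw [ha]; field_simp
    rw [← mul_pow, ← mul_pow, l, ← mul_zpow, r, zpow_neg, zpow_neg, zpow_add_one₀ hq,
      zpow_add_one₀ (by positivity), zpow_natCast, zpow_natCast, ha]
    simp only [mul_pow, div_pow, pow_succ, pow_zero, one_mul]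
    field_simp
    ring
  have e1 := qShift_inv_div_qShift_neg hq ha0 hu c₁ k
  have e2 := qShift_zpow_div_qShift_neg hq c₂ k
  have e3 := qShift_zpow_div_qShift_neg hq c₃ k
  have e4 := qShift_zpow_div_qShift_neg hq c₄ k
  have e5 := qShift_zpow_div_qShift_neg hq c₅ k
  have e6 := qShift_zpow_div_qShift_neg hq c₆ k
  simp only [secondTerm, qShiftList, List.map_cons, List.map_nil, List.prod_cons, List.prod_nil,
    mul_one, mul_div_assoc (q ^ (-(k : ℤ)))]
  rw [pow_pentagonal, hk, ← b₂, ← b₃, ← b₄, ← b₅, ← a₂, ← a₃, ← a₄, ← a₅, ← b₆, ← b₁]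
  rw [show qShift (q / y) q k = qShift (q / (a * u₁)) q k by rw [a₁]]
  exact prod_six_neg_div_eq hR hZ e1 e2 e3 e4 e5 e6 hpow

end

/-! ### The terminating series and the final identity -/

theorem basicHypergeometric_four_three {q : ℂ} (hq : q ≠ 0) (n : ℕ) (a₁ a₂ a₃ b₁ b₂ b₃ : ℂ) :
    basicHypergeometric [q ^ (-(n : ℤ)), a₁, a₂, a₃] [b₁, b₂, b₃] q q
      = ∑ k ∈ Finset.range (n + 1), qShift (q ^ (-(n : ℤ))) q k * qShift a₁ q k * qShift a₂ q k
        * qShift a₃ q k / (qShift q q k * qShift b₁ q k * qShift b₂ q k * qShift b₃ q k)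
        * q ^ k := by
  rw [basicHypergeometric, tsum_eq_sum (s := Finset.range (n + 1))]
  · refine Finset.sum_congr rfl fun k _ => ?_
    simp [qShiftList, mul_assoc]
  · intro k hk
    have : qShift (q ^ (-(n : ℤ))) q k = 0 :=
      Finset.prod_eq_zero (i := n) (Finset.mem_range.2 (by simpa using hk))
        (by rw [zpow_neg, zpow_natCast, inv_mul_cancel₀ (pow_ne_zero _ hq), sub_self])
    simp only [qShiftList, List.map_cons, List.prod_cons, this, zero_mul, zero_div]

theorem corollary2p5 (q x y b c d e : ℂ) (n : ℕ)
    (hq0 : q ≠ 0) (hq1 : ‖q‖ < 1)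
    (hx : x ≠ 0) (hy : y ≠ 0) (hb : b ≠ 0) (hc : c ≠ 0) (hd : d ≠ 0) (he : e ≠ 0)
    -- no denominator of the two series and of the infinite product vanishes
    (hden : ∀ u ∈ [y, x * y, b / y, c / y, d / y, e / y,
        b / (x * y), c / (x * y), d / (x * y), e / (x * y),
        q ^ (-(n : ℤ)) * y / e, q ^ (-(n : ℤ)) * x * y / e], ∀ j : ℕ, u * q ^ j ≠ 1)
    -- no denominator of the terminating series vanishes
    (hphi : ∀ u ∈ [q ^ (1 - (n : ℤ)) / e, q * e / (x * y ^ 2)], ∀ j < n, u * q ^ j ≠ 1)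
    (hconv : ‖b * c * d / (x * y ^ 2 * q ^ (n + 1))‖ < 1) :
    Summable (fun k : ℕ => firstTerm q x y b c d e n k) ∧
    Summable (fun k : ℕ => secondTerm q x y b c d e n k) ∧
    (∑' k : ℕ, firstTerm q x y b c d e n k) - x ^ 2 * ∑' k : ℕ, secondTerm q x y b c d e n k
      = qShiftInfList [q, x, q / x, b, c, d, b * c / (x * y ^ 2), b * d / (x * y ^ 2),
            c * d / (x * y ^ 2)] q
          / qShiftInfList [y, x * y, b / y, c / y, d / y, b / (x * y), c / (x * y),
              d / (x * y), b * c * d / (q * x * y ^ 2)] q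
        * (e * q ^ n / (-y))
        * (qShiftList [e, q * e / (x * y ^ 2)] q n
          / qShiftList [e / y, e / (x * y)] q (n + 1))
        * basicHypergeometric [q ^ (-(n : ℤ)), q / b, q / c, q / d]
            [q ^ (1 - (n : ℤ)) / e, q * e / (x * y ^ 2), q ^ 2 * x * y ^ 2 / (b * c * d)] q q := by
  simp only [List.forall_mem_cons, List.not_mem_nil, IsEmpty.forall_iff, implies_true,
    and_true] at hden hphi
  obtain ⟨d₁, d₂, d₃, d₄, d₅, d₆, d₇, d₈, d₉, d₁₀, d₁₁, d₁₂⟩ := hden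
  obtain ⟨p₁, p₂⟩ := hphi
  have hqn : q ^ n ≠ 0 := pow_ne_zero _ hq0
  -- For each of the six parameters u below, au and qu are the corresponding denominator bases of
  -- the first and of the second series.
  obtain ⟨a, ha⟩ : ∃ a, a = q / x := ⟨_, rfl⟩
  obtain ⟨u₁, hu₁⟩ : ∃ u, u = x * y / q := ⟨_, rfl⟩
  obtain ⟨u₂, hu₂⟩ : ∃ u, u = b / (q * y) := ⟨_, rfl⟩
  obtain ⟨u₃, hu₃⟩ : ∃ u, u = c / (q * y) := ⟨_, rfl⟩
  obtain ⟨u₄, hu₄⟩ : ∃ u, u = d / (q * y) := ⟨_, rfl⟩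
  obtain ⟨w, hw⟩ : ∃ u, u = e / (q * y) := ⟨_, rfl⟩
  obtain ⟨w', hw'⟩ : ∃ u, u = q ^ (-(n : ℤ)) * x * y / (q * e) := ⟨_, rfl⟩
  have a₁ : a * u₁ = y := by rw [ha, hu₁]; field_simp
  have a₂ : a * u₂ = b / (x * y) := by rw [ha, hu₂]; field_simp
  have a₃ : a * u₃ = c / (x * y) := by rw [ha, hu₃]; field_simp
  have a₄ : a * u₄ = d / (x * y) := by rw [ha, hu₄]; field_simp
  have a₅ : a * w = e / (x * y) := by rw [ha, hw]; field_simp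
  have a₆ : a * w' = q ^ (-(n : ℤ)) * y / e := by rw [ha, hw']; field_simp
  have b₁ : q * u₁ = x * y := by rw [hu₁]; field_simp
  have b₂ : q * u₂ = b / y := by rw [hu₂]; field_simp
  have b₃ : q * u₃ = c / y := by rw [hu₃]; field_simp
  have b₄ : q * u₄ = d / y := by rw [hu₄]; field_simp
  have b₅ : q * w = e / y := by rw [hw]; field_simp
  have b₆ : q * w' = q ^ (-(n : ℤ)) * x * y / e := by rw [hw']; field_simp
  have adm : ∀ {u s t : ℂ}, a * u = s → q * u = t → (∀ j : ℕ, s * q ^ j ≠ 1) →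
      (∀ j : ℕ, t * q ^ j ≠ 1) → WPAdmissible q a u ∧ 1 - a * u ≠ 0 := by
    rintro u _ _ rfl rfl hs ht
    refine ⟨⟨fun i h => hs (i + 1) (by rw [← h]; ring), ht⟩, fun h => hs 0 ?_⟩
    rw [pow_zero, mul_one]
    exact (sub_eq_zero.1 h).symm
  obtain ⟨A₁, c₁⟩ := adm a₁ b₁ d₁ d₂
  obtain ⟨A₂, c₂⟩ := adm a₂ b₂ d₇ d₃
  obtain ⟨A₃, c₃⟩ := adm a₃ b₃ d₈ d₄
  obtain ⟨A₄, c₄⟩ := adm a₄ b₄ d₉ d₅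
  obtain ⟨A₅, c₅⟩ := adm a₅ b₅ d₁₀ d₆
  obtain ⟨A₆, c₆⟩ := adm a₆ b₆ d₁₁ d₁₂
  have ha0 : a ≠ 0 := by rw [ha]; positivity
  have n₁ : u₁ ≠ 0 := by rw [hu₁]; positivity
  have n₂ : u₂ ≠ 0 := by rw [hu₂]; positivity
  have n₃ : u₃ ≠ 0 := by rw [hu₃]; positivity
  have n₄ : u₄ ≠ 0 := by rw [hu₄]; positivity
  have hw0 : w ≠ 0 := by rw [hw]; positivity
  have hU : q * a ^ 2 * (u₁ * u₂ * u₃ * u₄) = b * c * d / (q * x * y ^ 2) := by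
    rw [ha, hu₁, hu₂, hu₃, hu₄]; field_simp
  have hww : w' = 1 / (a * w * q ^ (n + 1)) := by
    rw [hw', ha, hw, zpow_neg, zpow_natCast]; field_simp; ring
  -- The convergence hypothesis multiplied by ‖q‖^n.
  have hr : ‖q * a ^ 2 * (u₁ * u₂ * u₃ * u₄)‖ < ‖q‖ ^ n := by
    have : q * a ^ 2 * (u₁ * u₂ * u₃ * u₄) = b * c * d / (x * y ^ 2 * q ^ (n + 1)) * q ^ n := by
      rw [hU]; field_simp; ring
    rw [this, norm_mul, norm_pow]
    exact mul_lt_of_lt_one_left (pow_pos (norm_pos_iff.2 hq0) n) hconv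
  have hCe : q * w / u₁ = q * e / (x * y ^ 2) := by rw [hw, hu₁]; field_simp
  have hDe : a * q * u₁ * w = e := by rw [ha, hu₁, hw]; field_simp
  have e1 : qShift (a * w) q (n + 1) = (1 - a * w) * qShift (a * q * w) q n := by
    rw [qShift_succ', show a * w * q = a * q * w by ring]
  -- The linear factor 1 - q^(-n)y/e completes (e/y;q)_n to (e/y;q)_(n+1); the monomial released is
  -- the inverse of the prefactor e q^n/(-y).
  have e2 : (1 - a * w') * qShift (q * w) q n
      = -(q ^ (-(n : ℤ)) * y / e) * qShift (q * w) q (n + 1) := by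
    rw [qShift_succ, a₆, b₅, zpow_neg, zpow_natCast]
    field_simp
    ring
  have hQ : qShift (q * w) q n * qShift (a * q * w) q n ≠ 0 :=
    mul_ne_zero (qShift_ne_zero fun i _ => A₅.2 i) (qShift_ne_zero fun i _ => A₅.1 i)
  have key := (tsum_wpProd_mul_eq hq0 hq1 ha0 A₁ A₂ A₃ A₄ n₁ n₂ n₃ n₄ hr hw0 hww A₅ A₆
    (by rw [hCe]; exact p₂) (by rw [hDe]; exact p₁) hQ).div_const
      ((1 - a * u₁) * (1 - a * u₂) * (1 - a * u₃) * (1 - a * u₄) * (1 - a * w) * (1 - a * w'))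
  have hf := firstTerm_eq hq0 hx hy ha a₁ a₂ a₃ a₄ a₅ a₆ b₁ b₂ b₃ b₄ b₅ b₆
  have hg := secondTerm_eq hq0 hx hy ha a₁ a₂ a₃ a₄ a₅ a₆ b₁ b₂ b₃ b₄ b₅ b₆ c₁ c₂ c₃ c₄ c₅ c₆
  have sf : Summable fun k : ℕ => firstTerm q x y b c d e n k := by
    simp only [hf]
    exact key.summable.comp_injective (i := ((↑) : ℕ → ℤ)) Nat.cast_injective
  have sg' : Summable fun k : ℕ => -x ^ 2 * secondTerm q x y b c d e n k := by
    simp only [hg]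
    exact key.summable.comp_injective (i := fun k : ℕ => -((k : ℤ) + 1))
      fun i j h => by simpa using h
  have hx2 : -x ^ 2 ≠ 0 := neg_ne_zero.2 (pow_ne_zero 2 hx)
  have sg := (summable_mul_left_iff hx2).1 sg'
  refine ⟨sf, sg, ?_⟩
  rw [sub_eq_add_neg, ← neg_mul, ← tsum_mul_left]
  have hsplit := tsum_of_nat_of_neg_add_one (by simpa only [hf] using sf)
    (by simpa only [hg] using sg') |>.symm.trans key.tsum_eq
  simp only [hf, hg]
  rw [hsplit, wpSum_eq hq0 hq1 ha0 A₁ A₂ A₃ A₄ n₁ n₂ n₃ n₄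
    (hr.trans_le (pow_le_one₀ (norm_nonneg _) hq1.le)), basicHypergeometric_four_three hq0]
  have hinf : ∀ u : ℂ, qShiftInf (a * u) q = (1 - a * u) * qShiftInf (a * q * u) q := fun u => by
    rw [qShiftInf_eq_mul hq1, show a * u * q = a * q * u by ring]
  simp only [qShiftInfList, qShiftList, List.map_cons, List.map_nil, List.prod_cons,
    List.prod_nil, mul_one]
  rw [show 1 / (a * u₁ * u₂) = q / b by rw [a₁, hu₂]; field_simp,
    show 1 / (a * u₁ * u₃) = q / c by rw [a₁, hu₃]; field_simp,
    show 1 / (a * u₁ * u₄) = q / d by rw [a₁, hu₄]; field_simp,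
    show 1 / (a ^ 2 * (u₁ * u₂ * u₃ * u₄)) = q ^ 2 * x * y ^ 2 / (b * c * d) by
      rw [ha, hu₁, hu₂, hu₃, hu₄]; field_simp,
    show a * q * u₁ * u₂ = b by rw [ha, hu₁, hu₂]; field_simp,
    show a * q * u₁ * u₃ = c by rw [ha, hu₁, hu₃]; field_simp,
    show a * q * u₁ * u₄ = d by rw [ha, hu₁, hu₄]; field_simp,
    show a * q * u₂ * u₃ = b * c / (x * y ^ 2) by rw [ha, hu₂, hu₃]; field_simp,
    show a * q * u₂ * u₄ = b * d / (x * y ^ 2) by rw [ha, hu₂, hu₄]; field_simp,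
    show a * q * u₃ * u₄ = c * d / (x * y ^ 2) by rw [ha, hu₃, hu₄]; field_simp,
    show q / a = x by rw [ha]; field_simp, hU, hCe, hDe, ← a₂, ← a₃, ← a₄, ← a₅, ← b₂, ← b₃,
    ← b₄, ← b₅, ← b₁, ← ha, show qShiftInf y q = qShiftInf (a * u₁) q by rw [a₁], hinf u₁,
    hinf u₂, hinf u₃, hinf u₄, e1]
  have hsc : e * q ^ n / (-y) = (-(q ^ (-(n : ℤ)) * y / e))⁻¹ := by
    rw [zpow_neg, zpow_natCast]; field_simp
  rw [hsc]
  generalize (∑ k ∈ Finset.range (n + 1), _ : ℂ) = T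
  rw [div_div, show qShift (q * w) q n * qShift (a * q * w) q n * ((1 - a * u₁) * (1 - a * u₂)
      * (1 - a * u₃) * (1 - a * u₄) * (1 - a * w) * (1 - a * w'))
    = ((1 - a * w') * qShift (q * w) q n) * (qShift (a * q * w) q n * ((1 - a * u₁) * (1 - a * u₂)
      * (1 - a * u₃) * (1 - a * u₄) * (1 - a * w))) by ring, e2]
  simp only [div_eq_mul_inv, mul_inv]
  ring
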